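/- Let $n\ge 1$, let $V=\langle e_1,\dots,e_n\rangle$ be an $n$-dimensional complex vector space, and let $\mathcal V=\Lambda^{\infty/2}(V\otimes\mathbb C[z^{-1},z])$ be the space spanned by the semi-infinite wedge products of vectors $e_iz^d$ whose tail is a tail of the vacuum vector $|0\rangle=(e_1z^0)\wedge\cdots\wedge(e_nz^0)\wedge(e_1z^1)\wedge\cdots$; these wedge products, with their factors in the order in which the $e_iz^d$ are listed by $d$ and then by $i$, form an orthonormal basis for the bilinear pairing $\langle\cdot|\cdot\rangle$, and $\partial_{(e_iz^d)}$ denotes contraction. A matrix series $B=\sum_{k\ge0}B_kz^k$ or $B=\sum_{k\ge 0}B_kz^{-k}$ with $B_k\in\mathrm{End}(V)$ is called symplectic if $B^t(-z)B(z)=\mathrm{Id}\cdot z^0$. It acts on $\mathcal V$ by $v_1\wedge v_2\wedge\cdots\mapsto Bv_1\wedge Bv_2\wedge\cdots$, i.e. its matrix elements are the corresponding minors, normalized by $\langle0|B|0\rangle=1$. Let $A$ be a finite product of such operators, where a product of two operators is formed when the right one has finitely supported columns or the left one has finitely supported rows in the above basis (for instance $A=A_-(z^{-1})A_+(z)$).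 An element $mz^k$ with $m\in\mathrm{End}(V)$ acts on $\mathcal V$ by the Leibniz rule; let $\alpha_i=E_{ii}z$, let $u_1,\dots,u_n$ be formal variables, $\mathcal A=\exp(\sum_i\alpha_iu_i)A$, and assume that the formal power series $\langle 0|\mathcal A|0\rangle$ in $u_1,\dots,u_n$ is not zero. In the fraction field of $\mathbb C[[u_1,\dots,u_n]]$ put $$\gamma_{ij}(A)=-\frac{\big\langle (e_iz^{-1})\wedge\partial_{(e_jz^0)}|0\rangle\,\big|\,\mathcal A\,\big|\,|0\rangle\big\rangle}{\langle0|\mathcal A|0\rangle}\quad(i\ne j),\qquad (\Psi_d)_{ij}(A)=\frac{\big\langle (e_iz^{-1})\wedge|0\rangle\,\big|\,\mathcal A\,\big|\,(e_jz^{-1-d})\wedge|0\rangle\big\rangle}{\langle0|\mathcal A|0\rangle}\quad(d\ge0).$$ The same formula defines $\gamma_{ij}$ of the formal family $A\exp(\epsilon X)$ as a power series in the formal variable $\epsilon$. Write $\mathsf{n.d.}$ for a matrix considered up to its diagonal entries. Let $\ell\ge0$, and let $r$, $s$ be complex $n\times n$ matrices that are symmetric if $\ell$ is odd and skew-symmetric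 if $\ell$ is even. Then $$\left.\frac{\partial}{\partial\epsilon}\right|_{\epsilon=0}\mathsf{n.d.}\,\gamma\big(A\exp(\epsilon\, r z^{-\ell})\big)=\mathsf{n.d.}\sum_{i+j=\ell-1}(-1)^{j-1}\,\Psi_i(A)\,r\,\Psi_j^t(A),$$ where the sum is over integers $i,j\ge 0$ (it is empty for $\ell=0$), and $$\left.\frac{\partial}{\partial\epsilon}\right|_{\epsilon=0}\mathsf{n.d.}\,\gamma\big(A\exp(\epsilon\, s z^{\ell})\big)=0.$$ -/

import Mathlib

noncomputable section

namespace VanDeLeur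

/-- The basis vectors `e_i z^d` of `V ⊗ ℂ[z⁻¹, z]`, `V = ⟨e_1, …, e_n⟩`. The order is the one in
which they occur in the vacuum vector: first by the power `d`, then by the index `i`. -/
abbrev Mode (n : ℕ) : Type := ℤ ×ₗ Fin n

/-- The basis vector `e_i z^d`. -/
def mode {n : ℕ} (i : Fin n) (d : ℤ) : Mode n := toLex (d, i)

/-- The power of `z` in a basis vector. -/
def deg {n : ℕ} (p : Mode n) : ℤ := (ofLex p).1

/-- The index `i` of a basis vector `e_i z^d`. -/
def idx {n : ℕ} (p : Mode n) : Fin n := (ofLex p).2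

/-- The set of factors of a semi-infinite wedge product whose tail is a tail of the vacuum vector:
the powers of `z` are bounded below, and all basis vectors of sufficiently large power occur.
The set stands for the wedge product of its elements in increasing order. -/
@[ext]
structure Maya (n : ℕ) where
  carrier : Set (Mode n)
  bounded_below : ∃ a : ℤ, ∀ p ∈ carrier, a ≤ deg p
  tail : ∃ b : ℤ, ∀ p, b ≤ deg p → p ∈ carrier

namespace Maya

variable {n : ℕ}

/-- The factors of the vacuum vector: all `e_i z^d` with `d ≥ 0`. -/
def vacuum : Maya n where
  carrier := {p | 0 ≤ deg p}
  bounded_below := ⟨0, fun _ hp => hp⟩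
  tail := ⟨0, fun _ hp => hp⟩

/-- Add a factor. -/
def insert (p : Mode n) (v : Maya n) : Maya n where
  carrier := Insert.insert p v.carrier
  bounded_below := by
    obtain ⟨a, ha⟩ := v.bounded_below
    refine ⟨min a (deg p), fun q hq => ?_⟩
    rcases hq with rfl | hq
    · exact min_le_right _ _
    · exact (min_le_left _ _).trans (ha q hq)
  tail := by
    obtain ⟨b, hb⟩ := v.tail
    exact ⟨b, fun q hq => Set.mem_insert_of_mem _ (hb q hq)⟩

/-- Remove a factor. -/
def erase (p : Mode n) (v : Maya n) : Maya n where
  carrier := v.carrier \ {p}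
  bounded_below := by
    obtain ⟨a, ha⟩ := v.bounded_below
    exact ⟨a, fun q hq => ha q hq.1⟩
  tail := by
    obtain ⟨b, hb⟩ := v.tail
    refine ⟨max b (deg p + 1), fun q hq => ⟨hb q ((le_max_left _ _).trans hq), ?_⟩⟩
    rintro rfl
    have := (le_max_right b (deg q + 1)).trans hq
    omega

theorem below_finite (v : Maya n) (N : ℕ) :
    {p : Mode n | p ∈ v.carrier ∧ deg p < (N : ℤ)}.Finite := by
  obtain ⟨a, ha⟩ := v.bounded_below
  refine (((Set.finite_Icc a (N : ℤ)).prod (Set.finite_univ (α := Fin n))).image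
    (toLex : ℤ × Fin n → Mode n)).subset ?_
  rintro p ⟨hp, hN⟩
  exact ⟨ofLex p, ⟨⟨ha p hp, hN.le⟩, Set.mem_univ _⟩, rfl⟩

/-- The finitely many factors with power of `z` less than `N`. -/
def below (v : Maya n) (N : ℕ) : Finset (Mode n) := (v.below_finite N).toFinset

/-- The sign `(-1)^k`, where `k` is the number of factors that stand before the place of `p`. -/
def sign (p : Mode n) (v : Maya n) : ℂ := (-1) ^ {q ∈ v.carrier | q < p}.ncard

end Maya

/-- The space `Λ^{∞/2}(V ⊗ ℂ[z⁻¹, z])`. -/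
abbrev Fock (n : ℕ) : Type := Maya n →₀ ℂ

variable {n : ℕ}

/-- The vacuum vector `|0⟩`. -/
def vac : Fock n := Finsupp.single Maya.vacuum 1

open Classical in
/-- Exterior multiplication `ω ↦ p ∧ ω` by a basis vector `p`. -/
def wedge (p : Mode n) : Fock n →ₗ[ℂ] Fock n :=
  Finsupp.linearCombination ℂ fun v =>
    if p ∈ v.carrier then 0 else Finsupp.single (v.insert p) (v.sign p)

open Classical in
/-- The contraction `ω ↦ ∂_p ω`. -/
def contract (p : Mode n) : Fock n →ₗ[ℂ] Fock n :=
  Finsupp.linearCombination ℂ fun v =>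
    if p ∈ v.carrier then Finsupp.single (v.erase p) (v.sign p) else 0

/-- The extension by the Leibniz rule to the semi-infinite wedge space of the operator `m z^k`,
that is, `e_j z^d ↦ ∑ i, m i j • e_i z^(d+k)`. On a wedge product only finitely many `d` contribute
if `k ≠ 0` or `m` has trace `0`. -/
def leibniz (m : Matrix (Fin n) (Fin n) ℂ) (k : ℤ) : Fock n →ₗ[ℂ] Fock n :=
  Finsupp.linearCombination ℂ fun v =>
    ∑ᶠ d : ℤ, ∑ i, ∑ j, m i j • wedge (mode i (d + k)) (contract (mode j d) (Finsupp.single v 1))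

/-- The operator `α_i`, the Leibniz extension of `e_j z^d ↦ δ_{ij} e_j z^(d+1)`. -/
def alpha (i : Fin n) : Module.End ℂ (Fock n) := leibniz (Matrix.single i i 1) 1

/-- The coefficient at the monomial `u^m` of `exp (∑ i, α_i u_i)` (the `α_i` commute). -/
def expAlpha (m : Fin n →₀ ℕ) : Module.End ℂ (Fock n) :=
  (List.ofFn fun i : Fin n => ((m i).factorial : ℂ)⁻¹ • alpha i ^ m i).prod

/-- An operator given by its matrix elements `⟨w| M |v⟩`. The image of a vector may be
an infinite combination of basis vectors. -/
abbrev Op (n : ℕ) : Type := Maya n → Maya n → ℂ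

/-- The symplectic condition `B^t(-z) B(z) = Id · z⁰` for `B(z) = ∑ k, B k z^k`; for a series in
`z⁻¹` the condition on the coefficients is the same. -/
def IsSymplecticSeries (B : ℕ → Matrix (Fin n) (Fin n) ℂ) : Prop :=
  ∀ m : ℕ, ∑ p ∈ Finset.HasAntidiagonal.antidiagonal m, (-1 : ℂ) ^ p.1 • ((B p.1).transpose * B p.2) =
    if m = 0 then 1 else 0

/-- The coefficient at `p` of the image of the basis vector `q` under `∑ k, B k z^k`. -/
def plusEntry (B : ℕ → Matrix (Fin n) (Fin n) ℂ) (p q : Mode n) : ℂ :=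
  if deg q ≤ deg p then B (deg p - deg q).toNat (idx p) (idx q) else 0

/-- The coefficient at `p` of the image of the basis vector `q` under `∑ k, B k z^(-k)`. -/
def minusEntry (B : ℕ → Matrix (Fin n) (Fin n) ℂ) (p q : Mode n) : ℂ :=
  if deg p ≤ deg q then B (deg q - deg p).toNat (idx p) (idx q) else 0

/-- The minor of `T` with rows `P` and columns `Q`, both in increasing order. -/
def minor (T : Mode n → Mode n → ℂ) (P Q : Finset (Mode n)) : ℂ :=
  if h : P.card = Q.card then
    Matrix.det (Matrix.of fun a b : Fin Q.card =>
      T (P.orderEmbOfFin h a) (Q.orderEmbOfFin rfl b))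
  else 0

open Classical in
/-- The value that a sequence takes for all large `N` (and `0` if there is none). -/
def eventualValue (f : ℕ → ℂ) : ℂ :=
  if h : ∃ c, ∀ᶠ N in Filter.atTop, f N = c then h.choose else 0

/-- The action `v₁ ∧ v₂ ∧ ⋯ ↦ T v₁ ∧ T v₂ ∧ ⋯` of an invertible series in `z` or in `z⁻¹` on the
semi-infinite wedge space. The matrix element `⟨w| T |v⟩` is the minor of `T` with rows `w` and
columns `v`, normalized by `⟨0| T |0⟩ = 1`; for such a series the quotients of truncated
minors do not depend on `N` from some `N` on. -/
def groupOp (T : Mode n → Mode n → ℂ) : Op n := fun w v =>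
  eventualValue fun N =>
    minor T (w.below N) (v.below N) /
      minor T ((Maya.vacuum : Maya n).below N) ((Maya.vacuum : Maya n).below N)

/-- The operators `A`: finite products of (the actions of) series in `z` and series in `z⁻¹` with
the symplectic condition. The product of two operators is formed where it makes sense for formal
series: where the second factor maps every basis vector to a finite combination of basis vectors,
or the transpose of the first one does. -/
inductive IsSymplecticOp : Op n → Prop
  | plus (B : ℕ → Matrix (Fin n) (Fin n) ℂ) (hB : IsSymplecticSeries B) :
      IsSymplecticOp (groupOp (plusEntry B))
  | minus (B : ℕ → Matrix (Fin n) (Fin n) ℂ) (hB : IsSymplecticSeries B) :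
      IsSymplecticOp (groupOp (minusEntry B))
  | mul (M M' : Op n) (hM : IsSymplecticOp M) (hM' : IsSymplecticOp M')
      (hfin : (∀ w, {x | M w x ≠ 0}.Finite) ∨ (∀ v, {x | M' x v ≠ 0}.Finite)) :
      IsSymplecticOp (fun w v => ∑ᶠ x, M w x * M' x v)

/-- The bilinear pairing in which the wedge products of basis vectors are orthonormal. -/
def pairing (a b : Fock n) : ℂ := a.sum fun w c => c * b w

/-- The matrix element `⟨a| exp (∑ i, α_i u_i) A |b⟩`, a formal power series in `u_1, …, u_n`.
Each coefficient is a finite sum over the basis vectors `x`. -/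
def matrixElement (A : Op n) (a b : Fock n) : MvPowerSeries (Fin n) ℂ := fun m =>
  ∑ᶠ x : Maya n, pairing a (expAlpha m (Finsupp.single x 1)) * b.sum fun y c => A x y * c

/-- The field of fractions of the ring of formal power series in `u_1, …, u_n`. -/
abbrev K (n : ℕ) : Type := FractionRing (MvPowerSeries (Fin n) ℂ)

/-- The wave function matrices
`(Ψ_d)_{ij} = ⟨(e_i z⁻¹) ∧ |0⟩| 𝒜 |(e_j z^(-1-d)) ∧ |0⟩⟩ / ⟨0| 𝒜 |0⟩`. -/
def Psi (A : Op n) (d : ℕ) : Matrix (Fin n) (Fin n) (K n) := Matrix.of fun i j =>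
  algebraMap (MvPowerSeries (Fin n) ℂ) (K n)
      (matrixElement A (wedge (mode i (-1)) vac) (wedge (mode j (-1 - (d : ℤ))) vac)) /
    algebraMap (MvPowerSeries (Fin n) ℂ) (K n) (matrixElement A vac vac)

/-- The formal family `A exp (ε X)` of operators, as the sequence of its coefficients at `ε^k`,
where `X` is an operator on the semi-infinite wedge space. -/
def expDeformation (A : Op n) (X : Module.End ℂ (Fock n)) : ℕ → Op n := fun k w v =>
  (((k.factorial : ℂ)⁻¹ • X ^ k) (Finsupp.single v 1)).sum fun y c => A w y * c

/-- The matrix element of a formal family `∑ k, F k ε^k`, a power series in `ε`. -/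
def familyElement (F : ℕ → Op n) (a b : Fock n) : PowerSeries (K n) := PowerSeries.mk fun k =>
  algebraMap (MvPowerSeries (Fin n) ℂ) (K n) (matrixElement (F k) a b)

/-- The matrix `γ` of a formal family of operators:
`γ_{ij} = - ⟨(e_i z⁻¹) ∧ ∂_{e_j z⁰} |0⟩| 𝒜 |0⟩ / ⟨0| 𝒜 |0⟩`, a power series in `ε`. Only its
entries with `i ≠ j` are of interest. -/
def gamma (F : ℕ → Op n) : Matrix (Fin n) (Fin n) (PowerSeries (K n)) := Matrix.of fun i j =>
  -(familyElement F (wedge (mode i (-1)) (contract (mode j 0) vac)) vac) *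
    (familyElement F vac vac)⁻¹

/-- The derivative at `ε = 0`. -/
def ddε (f : PowerSeries (K n)) : K n :=
  PowerSeries.constantCoeff (PowerSeries.derivative (K n) f)

/-- Equality `n.d. M = n.d. M'` of matrices with non-specified diagonal. -/
def NDEq {R : Type*} (M M' : Matrix (Fin n) (Fin n) R) : Prop :=
  ∀ i j, i ≠ j → M i j = M' i j

/-- Symmetric for odd `ℓ`, skew-symmetric for even `ℓ`. -/
def HasParity (ℓ : ℕ) (m : Matrix (Fin n) (Fin n) ℂ) : Prop :=
  (Odd ℓ → m.transpose = m) ∧ (Even ℓ → m.transpose = -m)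

end VanDeLeur

end

noncomputable section

namespace VanDeLeur

variable {n : ℕ}

/-! Two quadratic identities carry the proof. The operator `bilinearOp`, which is `∑ p, p ∧ ⊗ ∂_p`,
commutes with `A ⊗ A` for every `A` given by minors: this is Laplace expansion. The operator
`symplecticOp`, which pairs `e_i z^d` with `e_i z^(-1-d)` with sign `(-1)^d`, commutes with `A ⊗ A`
because `B(z)` preserves the form `∑ (-1)^d e_i z^d ⊗ e_i z^(-1-d)`. Both also commute with the
action of every `α_i` on the tensor square, so both identities hold for `𝒜 = exp(∑ α_i u_i) A`
(`element2_intertwines`).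

The first identity, tested on `∂_q|0⟩ ⊗ p ∧ |0⟩` against `p' ∧ ∂_{q'}|0⟩ ⊗ |0⟩`, turns a 2×2
determinant of matrix elements into the product `⟨∂_{q'}|0⟩|𝒜|∂_q|0⟩⟩ ⟨p' ∧ |0⟩|𝒜|p ∧ |0⟩⟩`
(`element_plucker`). The second, tested near the vacuum and divided by `⟨0|𝒜|0⟩ ≠ 0`, replaces the
factor with contractions by a wave function entry, up to a sign (`element_contract_vac`).

By the quotient rule the derivative of `γ` is minus such a determinant, linear in `X|0⟩`, over
`⟨0|𝒜|0⟩²` (`ddε_gamma`). For `X = r z^(-ℓ)` the vector `X|0⟩` is the finite sum of `r_{ab} e_a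
z^(d-ℓ) ∧ ∂_{e_b z^d}|0⟩` over `0 ≤ d < ℓ`; each term gives `(-1)^d` times an entry of `Ψ_{ℓ-1-d}`
times an entry of `Ψ_d`. The operator `s z^ℓ` kills the vacuum, so its derivative vanishes; for `ℓ =
0` this needs the zero diagonal of a skew-symmetric matrix. -/

theorem deg_mode (i : Fin n) (d : ℤ) : deg (mode i d) = d := rfl

theorem idx_mode (i : Fin n) (d : ℤ) : idx (mode i d) = i := rfl

theorem mode_idx_deg (p : Mode n) : mode (idx p) (deg p) = p := rfl

theorem mode_injective {i j : Fin n} {d e : ℤ} : mode i d = mode j e ↔ i = j ∧ d = e := by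
  constructor
  · intro h
    exact ⟨congrArg idx h, congrArg deg h⟩
  · rintro ⟨rfl, rfl⟩
    rfl

theorem deg_le_of_le {p q : Mode n} (h : p ≤ q) : deg p ≤ deg q :=
  Prod.Lex.monotone_fst p q h

theorem lt_of_deg_lt {p q : Mode n} (h : deg p < deg q) : p < q :=
  Prod.Lex.lt_iff.2 (Or.inl h)

theorem finite_deg_mem_Icc (a b : ℤ) : {p : Mode n | a ≤ deg p ∧ deg p ≤ b}.Finite := by
  refine (((Set.finite_Icc a b).prod (Set.finite_univ (α := Fin n))).image
    (toLex : ℤ × Fin n → Mode n)).subset ?_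
  rintro p ⟨hp, hN⟩
  exact ⟨ofLex p, ⟨⟨hp, hN⟩, Set.mem_univ _⟩, rfl⟩

/-! ### Signs, and the anticommutation relations of exterior multiplication and contraction. -/

namespace Maya

theorem mem_insert {p q : Mode n} {v : Maya n} :
    q ∈ (v.insert p).carrier ↔ q = p ∨ q ∈ v.carrier := Iff.rfl

theorem mem_erase {p q : Mode n} {v : Maya n} :
    q ∈ (v.erase p).carrier ↔ q ∈ v.carrier ∧ q ≠ p := Iff.rfl

theorem mem_vacuum {p : Mode n} : p ∈ (vacuum : Maya n).carrier ↔ 0 ≤ deg p := Iff.rfl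

theorem ext_mem {v w : Maya n} (h : ∀ p, p ∈ v.carrier ↔ p ∈ w.carrier) : v = w :=
  Maya.ext (Set.ext h)

theorem insert_erase {p : Mode n} {v : Maya n} (h : p ∈ v.carrier) :
    (v.erase p).insert p = v := by
  apply ext_mem
  intro q
  simp only [mem_insert, mem_erase]
  grind

theorem erase_insert {p : Mode n} {v : Maya n} (h : p ∉ v.carrier) :
    (v.insert p).erase p = v := by
  apply ext_mem
  intro q
  simp only [mem_insert, mem_erase]
  grind

theorem insert_insert_comm (p q : Mode n) (v : Maya n) :
    (v.insert p).insert q = (v.insert q).insert p := by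
  apply ext_mem
  intro r
  simp only [mem_insert]
  tauto

theorem erase_erase_comm (p q : Mode n) (v : Maya n) :
    (v.erase p).erase q = (v.erase q).erase p := by
  apply ext_mem
  intro r
  simp only [mem_erase]
  tauto

theorem erase_insert_comm {p q : Mode n} (h : p ≠ q) (v : Maya n) :
    (v.insert p).erase q = (v.erase q).insert p := by
  apply ext_mem
  intro r
  simp only [mem_erase, mem_insert]
  grind

theorem finite_before (v : Maya n) (p : Mode n) : {q ∈ v.carrier | q < p}.Finite := by
  obtain ⟨a, ha⟩ := v.bounded_below
  exact (finite_deg_mem_Icc a (deg p)).subset fun q hq => ⟨ha q hq.1, deg_le_of_le hq.2.le⟩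

theorem sign_insert {p q : Mode n} {v : Maya n} (h : q ∉ v.carrier) :
    (v.insert q).sign p = (if q < p then -1 else 1) * v.sign p := by
  unfold sign
  split_ifs with hqp
  · have : {r ∈ (v.insert q).carrier | r < p} = Insert.insert q {r ∈ v.carrier | r < p} := by
      ext r
      simp only [Set.mem_ofPred_eq, mem_insert, Set.mem_insert_iff]
      grind
    rw [this, Set.ncard_insert_of_notMem (fun hq => h hq.1) (v.finite_before p), pow_succ]
    ring
  · have : {r ∈ (v.insert q).carrier | r < p} = {r ∈ v.carrier | r < p} := by
      ext r
      simp only [Set.mem_ofPred_eq, mem_insert]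
      grind
    rw [this, one_mul]

theorem sign_erase {p q : Mode n} {v : Maya n} (h : q ∈ v.carrier) :
    (v.erase q).sign p = (if q < p then -1 else 1) * v.sign p := by
  have := sign_insert (p := p) (q := q) (v := v.erase q) (fun hq => hq.2 rfl)
  rw [insert_erase h] at this
  rw [this]
  split_ifs <;> simp

theorem sign_mul_self (p : Mode n) (v : Maya n) : v.sign p * v.sign p = 1 := by
  unfold sign
  rw [← mul_pow]
  simp

end Maya

open Maya

open Classical in
theorem wedge_single (p : Mode n) (v : Maya n) (c : ℂ) :
    wedge p (Finsupp.single v c) =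
      if p ∈ v.carrier then 0 else Finsupp.single (v.insert p) (c * v.sign p) := by
  rw [wedge, Finsupp.linearCombination_single]
  split_ifs <;> simp

open Classical in
theorem contract_single (p : Mode n) (v : Maya n) (c : ℂ) :
    contract p (Finsupp.single v c) =
      if p ∈ v.carrier then Finsupp.single (v.erase p) (c * v.sign p) else 0 := by
  rw [contract, Finsupp.linearCombination_single]
  split_ifs <;> simp

theorem wedge_wedge (p q : Mode n) (f : Fock n) :
    wedge p (wedge q f) = -wedge q (wedge p f) := by
  classical
  suffices h : wedge p ∘ₗ wedge q = -(wedge q ∘ₗ wedge p) from LinearMap.congr_fun h f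
  ext1 v
  ext1
  simp only [LinearMap.comp_apply, LinearMap.neg_apply, Finsupp.lsingle_apply, wedge_single]
  by_cases hp : p ∈ v.carrier <;> by_cases hq : q ∈ v.carrier <;>
    simp only [hp, hq, if_true, if_false, wedge_single, map_zero, neg_zero, mem_insert, or_true]
  by_cases hpq : p = q
  · simp [hpq]
  · rw [if_neg (by tauto), if_neg (by tauto), sign_insert hp, sign_insert hq,
      insert_insert_comm, ← Finsupp.single_neg]
    congr 1
    rcases lt_or_gt_of_ne hpq with h | h <;> simp [h, h.not_gt, mul_comm]

theorem contract_contract (p q : Mode n) (f : Fock n) :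
    contract p (contract q f) = -contract q (contract p f) := by
  classical
  suffices h : contract p ∘ₗ contract q = -(contract q ∘ₗ contract p) from LinearMap.congr_fun h f
  ext1 v
  ext1
  simp only [LinearMap.comp_apply, LinearMap.neg_apply, Finsupp.lsingle_apply, contract_single]
  by_cases hp : p ∈ v.carrier <;> by_cases hq : q ∈ v.carrier <;>
    simp only [hp, hq, if_true, if_false, contract_single, map_zero, neg_zero, mem_erase,
      false_and, true_and]
  by_cases hpq : p = q
  · simp [hpq]
  · rw [if_pos hpq, if_pos (Ne.symm hpq), sign_erase hp, sign_erase hq,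
      erase_erase_comm, ← Finsupp.single_neg]
    congr 1
    rcases lt_or_gt_of_ne hpq with h | h <;> simp [h, h.not_gt, mul_comm]

theorem contract_wedge_self (p : Mode n) (f : Fock n) :
    contract p (wedge p f) = f - wedge p (contract p f) := by
  classical
  suffices h : contract p ∘ₗ wedge p = LinearMap.id - (wedge p ∘ₗ contract p) from
    LinearMap.congr_fun h f
  ext1 v
  ext1
  simp only [LinearMap.comp_apply, LinearMap.sub_apply, Finsupp.lsingle_apply, contract_single,
    wedge_single, LinearMap.id_apply]
  by_cases hp : p ∈ v.carrier
  · simp [hp, wedge_single, mem_erase, insert_erase hp, sign_erase hp, sign_mul_self]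
  · simp [hp, contract_single, mem_insert, erase_insert hp, sign_insert hp, sign_mul_self]

theorem contract_wedge {p q : Mode n} (hpq : p ≠ q) (f : Fock n) :
    contract p (wedge q f) = -wedge q (contract p f) := by
  classical
  suffices h : contract p ∘ₗ wedge q = -(wedge q ∘ₗ contract p) from LinearMap.congr_fun h f
  ext1 v
  ext1
  simp only [LinearMap.comp_apply, LinearMap.neg_apply, Finsupp.lsingle_apply, contract_single,
    wedge_single]
  by_cases hp : p ∈ v.carrier <;> by_cases hq : q ∈ v.carrier <;>
    simp only [hp, hq, if_true, if_false, contract_single, wedge_single, map_zero, neg_zero,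
      mem_erase, mem_insert, hpq, hpq.symm, or_true, or_false, true_and, false_and,
      ne_eq, not_false_eq_true]
  rw [sign_erase hp, sign_insert hq, erase_insert_comm hpq.symm, ← Finsupp.single_neg]
  congr 1
  rcases lt_or_gt_of_ne hpq with h | h <;> simp [h, h.not_gt, mul_comm]

/-- Together with `exists_contract_eq_zero` this bounds the degrees that contribute to the sums over
all modes below. -/
theorem exists_wedge_eq_zero (f : Fock n) : ∃ b : ℤ, ∀ p : Mode n, b ≤ deg p → wedge p f = 0 := by
  classical
  induction f using Finsupp.induction_linear with
  | zero => exact ⟨0, fun p _ => map_zero _⟩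
  | add f g hf hg =>
    obtain ⟨b, hb⟩ := hf
    obtain ⟨c, hc⟩ := hg
    refine ⟨max b c, fun p hp => ?_⟩
    rw [map_add, hb p ((le_max_left _ _).trans hp), hc p ((le_max_right _ _).trans hp), add_zero]
  | single v c =>
    obtain ⟨b, hb⟩ := v.tail
    exact ⟨b, fun p hp => by rw [wedge_single, if_pos (hb p hp)]⟩

theorem exists_contract_eq_zero (f : Fock n) :
    ∃ a : ℤ, ∀ p : Mode n, deg p < a → contract p f = 0 := by
  classical
  induction f using Finsupp.induction_linear with
  | zero => exact ⟨0, fun p _ => map_zero _⟩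
  | add f g hf hg =>
    obtain ⟨b, hb⟩ := hf
    obtain ⟨c, hc⟩ := hg
    refine ⟨min b c, fun p hp => ?_⟩
    rw [map_add, hb p (hp.trans_le (min_le_left _ _)), hc p (hp.trans_le (min_le_right _ _)),
      add_zero]
  | single v c =>
    obtain ⟨a, ha⟩ := v.bounded_below
    refine ⟨a, fun p hp => ?_⟩
    rw [contract_single, if_neg fun h => (ha p h).not_gt hp]

theorem wedge_vac {p : Mode n} (hp : 0 ≤ deg p) : wedge p vac = 0 := by
  rw [vac, wedge_single, if_pos (mem_vacuum.2 hp)]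

theorem contract_vac {p : Mode n} (hp : deg p < 0) : contract p vac = 0 := by
  rw [vac, contract_single, if_neg fun h => (mem_vacuum.1 h).not_gt hp]

end VanDeLeur

end

/-! ### Minors: Laplace expansion, bilinear relations, and stabilization under truncation. -/

noncomputable section

namespace VanDeLeur

variable {n : ℕ}

open Maya

/-- The sign `(-1)^k`, where `k` is the number of elements of `P` before `p`. -/
def finsetSign (p : Mode n) (P : Finset (Mode n)) : ℂ := (-1) ^ (P.filter (· < p)).card

theorem minor_eq_det {T : Mode n → Mode n → ℂ} {P Q : Finset (Mode n)} {k : ℕ}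
    {f g : Fin k → Mode n} (hf : StrictMono f) (hg : StrictMono g)
    (hP : P.card = k) (hQ : Q.card = k) (hfP : ∀ a, f a ∈ P) (hgQ : ∀ a, g a ∈ Q) :
    minor T P Q = Matrix.det (Matrix.of fun a b => T (f a) (g b)) := by
  subst hQ
  rw [minor, dif_pos hP, Finset.orderEmbOfFin_unique hP hfP hf,
    Finset.orderEmbOfFin_unique rfl hgQ hg]

theorem minor_of_card_ne {T : Mode n → Mode n → ℂ} {P Q : Finset (Mode n)}
    (h : P.card ≠ Q.card) : minor T P Q = 0 := by
  rw [minor, dif_neg h]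

/-- Lets statements about rows, or about series in `z⁻¹`, be deduced from those about columns and
series in `z`. -/
theorem minor_flip (T : Mode n → Mode n → ℂ) (P Q : Finset (Mode n)) :
    minor (fun p q => T q p) P Q = minor T Q P := by
  by_cases h : P.card = Q.card
  · rw [minor_eq_det (P.orderEmbOfFin rfl).strictMono (Q.orderEmbOfFin h.symm).strictMono rfl h.symm
      (P.orderEmbOfFin_mem rfl) (Q.orderEmbOfFin_mem h.symm),
      minor_eq_det (Q.orderEmbOfFin h.symm).strictMono (P.orderEmbOfFin rfl).strictMono h.symm rfl
      (Q.orderEmbOfFin_mem h.symm) (P.orderEmbOfFin_mem rfl), ← Matrix.det_transpose]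
    rfl
  · rw [minor_of_card_ne h, minor_of_card_ne (Ne.symm h)]

theorem finsetSign_orderEmbOfFin (P : Finset (Mode n)) {k : ℕ} (h : P.card = k) (i : Fin k) :
    finsetSign (P.orderEmbOfFin h i) P = (-1) ^ (i : ℕ) := by
  have : P.filter (· < P.orderEmbOfFin h i)
      = (Finset.Iio i).map (P.orderEmbOfFin h).toEmbedding := by
    ext p
    simp only [Finset.mem_filter, Finset.mem_map, Finset.mem_Iio]
    constructor
    · rintro ⟨hp, ha⟩
      obtain ⟨a, rfl⟩ : p ∈ Set.range (P.orderEmbOfFin h) := by simpa using hp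
      exact ⟨a, by simpa using ha, rfl⟩
    · rintro ⟨a, ha, rfl⟩
      exact ⟨P.orderEmbOfFin_mem h a, by simpa using ha⟩
  rw [finsetSign, this, Finset.card_map, Fin.card_Iio]

theorem sum_eq_sum_orderEmbOfFin (P : Finset (Mode n)) {k : ℕ} (h : P.card = k)
    (F : Mode n → ℂ) : ∑ p ∈ P, F p = ∑ i, F (P.orderEmbOfFin h i) := by
  conv_lhs => rw [← P.map_orderEmbOfFin_univ h]
  rw [Finset.sum_map]
  rfl

theorem minor_erase_eq_det {T : Mode n → Mode n → ℂ} {P Q : Finset (Mode n)} {k : ℕ}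
    (hP : P.card = k + 1) (hQ : Q.card = k) (i : Fin (k + 1)) {g : Fin k → Mode n}
    (hg : StrictMono g) (hgQ : ∀ a, g a ∈ Q) :
    minor T (P.erase (P.orderEmbOfFin hP i)) Q =
      Matrix.det (Matrix.of fun a b => T (P.orderEmbOfFin hP (i.succAbove a)) (g b)) := by
  refine minor_eq_det (f := fun a => P.orderEmbOfFin hP (i.succAbove a))
    ((P.orderEmbOfFin hP).strictMono.comp (Fin.strictMono_succAbove i)) hg ?_ hQ ?_ hgQ
  · rw [Finset.card_erase_of_mem (P.orderEmbOfFin_mem hP i), hP, Nat.add_sub_cancel]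
  · intro a
    refine Finset.mem_erase.2 ⟨fun h => ?_, P.orderEmbOfFin_mem hP _⟩
    exact Fin.succAbove_ne i a ((P.orderEmbOfFin hP).injective h)

/-- Expansion of a minor along the column `q`. -/
theorem minor_expand_column (T : Mode n → Mode n → ℂ) (P Q : Finset (Mode n)) (q : Mode n) :
    (if q ∈ Q then 0 else finsetSign q Q * minor T P (insert q Q)) =
      ∑ p ∈ P, finsetSign p P * T p q * minor T (P.erase p) Q := by
  by_cases hcard : P.card = Q.card + 1
  · rw [sum_eq_sum_orderEmbOfFin P hcard]
    simp only [finsetSign_orderEmbOfFin]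
    split_ifs with hq
    · obtain ⟨j, hj⟩ : ∃ j, Q.orderEmbOfFin rfl j = q := by
        have : q ∈ Set.range (Q.orderEmbOfFin rfl) := by simpa using hq
        exact this
      -- The column `q` occurs twice here, so the determinant vanishes; its expansion along the
      -- first copy is the right-hand side.
      have h0 : Matrix.det (Matrix.of fun a b : Fin (Q.card + 1) =>
          T (P.orderEmbOfFin hcard a)
            ((Fin.cons q (Q.orderEmbOfFin rfl) : Fin (Q.card + 1) → Mode n) b)) = 0 :=
        Matrix.det_zero_of_column_eq (i := 0) (j := j.succ) (Fin.succ_ne_zero j).symm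
          fun a => by simp [hj]
      rw [Matrix.det_succ_column _ 0] at h0
      rw [← h0]
      refine Finset.sum_congr rfl fun i _ => ?_
      rw [minor_erase_eq_det hcard rfl i (Q.orderEmbOfFin rfl).strictMono
        (Q.orderEmbOfFin_mem rfl)]
      simp only [Fin.val_zero, add_zero, Matrix.of_apply, Fin.cons_zero]
      congr 2
    · have hins : (insert q Q).card = Q.card + 1 := Finset.card_insert_of_notMem hq
      obtain ⟨j, hj⟩ : ∃ j, (insert q Q).orderEmbOfFin hins j = q := by
        have : q ∈ Set.range ((insert q Q).orderEmbOfFin hins) := by simp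
        exact this
      have hsign : finsetSign q Q = (-1) ^ (j : ℕ) := by
        rw [← finsetSign_orderEmbOfFin _ hins, hj, finsetSign, finsetSign, Finset.filter_insert,
          if_neg (lt_irrefl q)]
      rw [minor_eq_det (P.orderEmbOfFin hcard).strictMono
        ((insert q Q).orderEmbOfFin hins).strictMono hcard hins (P.orderEmbOfFin_mem hcard)
        ((insert q Q).orderEmbOfFin_mem hins), Matrix.det_succ_column _ j, Finset.mul_sum, hsign]
      refine Finset.sum_congr rfl fun i _ => ?_
      rw [minor_erase_eq_det hcard rfl i
        (((insert q Q).orderEmbOfFin hins).strictMono.comp (Fin.strictMono_succAbove j))]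
      · simp only [Matrix.of_apply, hj, pow_add]
        -- The factor `(-1)^j` of the cofactor expansion cancels against `finsetSign q Q`, which is
        -- the same `(-1)^j`.
        have : ((-1 : ℂ) ^ (j : ℕ)) * (-1) ^ (j : ℕ) = 1 := by
          rw [← mul_pow]
          simp
        rw [show ∀ a b c d : ℂ, a * (b * a * c * d) = (a * a) * (b * c * d) by intros; ring,
          this, one_mul]
        rfl
      · intro a
        have := (insert q Q).orderEmbOfFin_mem hins (j.succAbove a)
        refine (Finset.mem_insert.1 this).resolve_left fun h => ?_
        exact Fin.succAbove_ne j a (((insert q Q).orderEmbOfFin hins).injective (h.trans hj.symm))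
  · have hl : (if q ∈ Q then 0 else finsetSign q Q * minor T P (insert q Q)) = 0 := by
      split_ifs with hq
      · rfl
      · rw [minor_of_card_ne, mul_zero]
        rwa [Finset.card_insert_of_notMem hq]
    rw [hl]
    refine (Finset.sum_eq_zero fun p hp => ?_).symm
    rw [minor_of_card_ne, mul_zero]
    have := Finset.card_erase_add_one hp
    omega

/-- Expansion of a minor along the row `p`. -/
theorem minor_expand_row (T : Mode n → Mode n → ℂ) (P Q : Finset (Mode n)) (p : Mode n) :
    (if p ∈ P then 0 else finsetSign p P * minor T (insert p P) Q) =
      ∑ q ∈ Q, finsetSign q Q * T p q * minor T P (Q.erase q) := by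
  have := minor_expand_column (fun p q => T q p) Q P p
  simpa only [minor_flip] using this

/-- The bilinear relation between minors that expresses the invariance of `∑ p, p ⊗ ∂_p`. -/
theorem minor_bilinear (T : Mode n → Mode n → ℂ) (P P' Q Q' : Finset (Mode n)) :
    ∑ q ∈ Q', (if q ∈ Q then 0 else finsetSign q Q * minor T P (insert q Q)) *
        (finsetSign q Q' * minor T P' (Q'.erase q)) =
      ∑ p ∈ P, (finsetSign p P * minor T (P.erase p) Q) *
        (if p ∈ P' then 0 else finsetSign p P' * minor T (insert p P') Q') := by
  -- Expanding the enlarged minor along its new column on the left, and along its new row on the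
  -- right, gives the same double sum over `P` and `Q'`, with entry `T p q`.
  simp only [minor_expand_column, minor_expand_row, Finset.sum_mul, Finset.mul_sum]
  rw [Finset.sum_comm]
  refine Finset.sum_congr rfl fun p _ => Finset.sum_congr rfl fun q _ => ?_
  ring

theorem strictMono_append {α : Type*} [Preorder α] {k m : ℕ} {f : Fin k → α} {g : Fin m → α}
    (hf : StrictMono f) (hg : StrictMono g) (hfg : ∀ a b, f a < g b) :
    StrictMono (Fin.append f g) := by
  intro a b
  refine Fin.addCases (fun a => ?_) (fun a => ?_) a <;>
    refine Fin.addCases (fun b => ?_) (fun b => ?_) b <;> intro h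
  · simp only [Fin.append_left]
    exact hf h
  · simpa using hfg a b
  · exfalso
    simp only [Fin.lt_def, Fin.val_natAdd, Fin.val_castAdd] at h
    omega
  · simp only [Fin.append_right]
    simp only [Fin.lt_def, Fin.val_natAdd] at h
    exact hg (by omega)

/-- Multiplicativity of a block triangular minor. -/
theorem minor_union {T : Mode n → Mode n → ℂ} {P Q L : Finset (Mode n)}
    (hP : ∀ p ∈ P, ∀ q ∈ L, p < q) (hQ : ∀ p ∈ Q, ∀ q ∈ L, p < q)
    (hT : ∀ p ∈ P, ∀ q ∈ L, T p q = 0) :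
    minor T (P ∪ L) (Q ∪ L) = minor T P Q * minor T L L := by
  have hPL : (P ∪ L).card = P.card + L.card := Finset.card_union_of_disjoint
    (Finset.disjoint_left.2 fun p hp hq => lt_irrefl _ (hP p hp p hq))
  have hQL : (Q ∪ L).card = Q.card + L.card := Finset.card_union_of_disjoint
    (Finset.disjoint_left.2 fun p hp hq => lt_irrefl _ (hQ p hp p hq))
  by_cases h : P.card = Q.card
  · rw [h] at hPL
    have mP := P.orderEmbOfFin_mem h
    have mQ := Q.orderEmbOfFin_mem rfl
    have mL := L.orderEmbOfFin_mem rfl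
    rw [minor_eq_det (P.orderEmbOfFin h).strictMono (Q.orderEmbOfFin rfl).strictMono h rfl mP mQ,
      minor_eq_det (L.orderEmbOfFin rfl).strictMono (L.orderEmbOfFin rfl).strictMono rfl rfl mL mL,
      minor_eq_det
        (strictMono_append (P.orderEmbOfFin h).strictMono (L.orderEmbOfFin rfl).strictMono
          fun a b => hP _ (mP a) _ (mL b))
        (strictMono_append (Q.orderEmbOfFin rfl).strictMono (L.orderEmbOfFin rfl).strictMono
          fun a b => hQ _ (mQ a) _ (mL b)) hPL hQL,
      ← Matrix.det_submatrix_equiv_self finSumFinEquiv]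
    · rw [← Matrix.det_fromBlocks_zero₁₂ _ (Matrix.of fun a b =>
        T (L.orderEmbOfFin rfl a) (Q.orderEmbOfFin rfl b))]
      congr 1
      ext (a | a) (b | b) <;> simp [hT _ (mP _) _ (mL _)]
    · intro a
      refine Fin.addCases (fun a => ?_) (fun a => ?_) a
      · simp
      · simp
    · intro a
      refine Fin.addCases (fun a => ?_) (fun a => ?_) a
      · simp
      · simp
  · rw [minor_of_card_ne h, minor_of_card_ne (by omega), zero_mul]

/-- The basis vectors `e_i z^N`. -/
def level (n : ℕ) (N : ℤ) : Finset (Mode n) :=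
  Finset.univ.map ⟨fun i : Fin n => mode i N, fun _ _ h => (mode_injective.1 h).1⟩

theorem mem_level {N : ℤ} {p : Mode n} : p ∈ level n N ↔ deg p = N := by
  simp only [level, Finset.mem_map, Finset.mem_univ, true_and]
  constructor
  · rintro ⟨i, rfl⟩
    rfl
  · rintro rfl
    exact ⟨idx p, mode_idx_deg p⟩

theorem minor_level (T : Mode n → Mode n → ℂ) (N : ℤ) :
    minor T (level n N) (level n N) =
      Matrix.det (Matrix.of fun i j => T (mode i N) (mode j N)) := by
  have hm : StrictMono fun i : Fin n => mode i N := fun i j h =>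
    Prod.Lex.lt_iff.2 (Or.inr ⟨rfl, h⟩)
  have hc : (level n N).card = n := by simp [level]
  exact minor_eq_det hm hm hc hc (fun _ => mem_level.2 rfl) (fun _ => mem_level.2 rfl)

namespace Maya

theorem mem_below {v : Maya n} {N : ℕ} {p : Mode n} :
    p ∈ v.below N ↔ p ∈ v.carrier ∧ deg p < N := by
  simp [below]

theorem below_succ {v : Maya n} {N : ℕ} (h : ∀ p, (N : ℤ) ≤ deg p → p ∈ v.carrier) :
    v.below (N + 1) = v.below N ∪ level n N := by
  ext p
  simp only [mem_below, Finset.mem_union, mem_level]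
  push_cast
  constructor
  · rintro ⟨hp, hN⟩
    by_cases h' : deg p = N
    · exact Or.inr h'
    · exact Or.inl ⟨hp, by omega⟩
  · rintro (⟨hp, hN⟩ | hp)
    · exact ⟨hp, by omega⟩
    · exact ⟨h p hp.ge, by omega⟩

theorem below_insert {v : Maya n} {N : ℕ} {p : Mode n} (hp : deg p < N) :
    (v.insert p).below N = Insert.insert p (v.below N) := by
  ext q
  simp only [mem_below, Finset.mem_insert, mem_insert]
  grind

theorem below_erase (v : Maya n) (N : ℕ) (p : Mode n) :
    (v.erase p).below N = (v.below N).erase p := by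
  ext q
  simp only [mem_below, Finset.mem_erase, mem_erase]
  grind

theorem finsetSign_below (v : Maya n) {N : ℕ} {p : Mode n} (hp : deg p < N) :
    finsetSign p (v.below N) = v.sign p := by
  rw [finsetSign, sign, ← Set.ncard_coe_finset]
  congr 2
  ext q
  simp only [Finset.coe_filter, mem_below, Set.mem_ofPred_eq]
  exact ⟨fun h => ⟨h.1.1, h.2⟩, fun h => ⟨⟨h.1, (deg_le_of_le h.2.le).trans_lt hp⟩, h.2⟩⟩

end Maya

/-- The quotients of truncated minors that define the action of `T` stabilize. -/
def IsStable (T : Mode n → Mode n → ℂ) : Prop :=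
  ∀ w v : Maya n, ∃ c, ∀ᶠ N : ℕ in Filter.atTop,
    minor T (w.below N) (v.below N) /
      minor T ((vacuum : Maya n).below N) ((vacuum : Maya n).below N) = c

/-- Removes the choice in `eventualValue`: under stability, matrix elements can be computed at any
sufficiently large truncation. -/
theorem IsStable.eventually_eq {T : Mode n → Mode n → ℂ} (hT : IsStable T) (w v : Maya n) :
    ∀ᶠ N : ℕ in Filter.atTop, minor T (w.below N) (v.below N) /
      minor T ((vacuum : Maya n).below N) ((vacuum : Maya n).below N) = groupOp T w v := by
  have h := hT w v
  rw [groupOp, eventualValue, dif_pos h]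
  exact h.choose_spec

theorem IsStable.flip {T : Mode n → Mode n → ℂ} (hT : IsStable T) :
    IsStable fun p q => T q p := by
  intro w v
  simpa only [minor_flip] using hT v w

/-- Once both sets contain all modes of degree at least `N`, passing from `N` to `N + 1` adds a
diagonal block `C` to a block triangular matrix. The numerator and the vacuum minor are both
multiplied by `det C ≠ 0`, so the quotient does not change. -/
theorem isStable_of_lowerTriangular {T : Mode n → Mode n → ℂ} {C : Matrix (Fin n) (Fin n) ℂ}
    (hC : C.det ≠ 0) (hT : ∀ p q, deg p < deg q → T p q = 0)
    (hTC : ∀ (N : ℤ) i j, T (mode i N) (mode j N) = C i j) : IsStable T := by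
  intro w v
  obtain ⟨b, hb⟩ := w.tail
  obtain ⟨b', hb'⟩ := v.tail
  have key : ∀ (w v : Maya n) (N : ℕ), (∀ p, (N : ℤ) ≤ deg p → p ∈ w.carrier) →
      (∀ p, (N : ℤ) ≤ deg p → p ∈ v.carrier) →
      minor T (w.below (N + 1)) (v.below (N + 1)) =
        minor T (w.below N) (v.below N) * C.det := by
    intro w v N hw hv
    have hlt : ∀ (w : Maya n), ∀ p ∈ w.below N, ∀ q ∈ level n (N : ℤ), deg p < deg q := by
      intro w p hp q hq
      rw [mem_level.1 hq]
      exact (mem_below.1 hp).2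
    rw [below_succ hw, below_succ hv,
      minor_union (fun p hp q hq => lt_of_deg_lt (hlt w p hp q hq))
        (fun p hp q hq => lt_of_deg_lt (hlt v p hp q hq))
        (fun p hp q hq => hT _ _ (hlt w p hp q hq)), minor_level]
    congr 2
    ext i j
    exact hTC N i j
  set N₀ : ℕ := (max b b').toNat with hN₀
  have hN₀b : ∀ N : ℕ, N₀ ≤ N → b ≤ N ∧ b' ≤ N := by
    intro N hN
    have := Int.self_le_toNat (max b b')
    have := le_max_left b b'
    have := le_max_right b b'
    omega
  refine ⟨minor T (w.below N₀) (v.below N₀) /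
    minor T ((vacuum : Maya n).below N₀) ((vacuum : Maya n).below N₀),
    Filter.eventually_atTop.2 ⟨N₀, fun N hN => ?_⟩⟩
  induction N, hN using Nat.le_induction with
  | base => rfl
  | succ N hN ih =>
    obtain ⟨h1, h2⟩ := hN₀b N hN
    rw [key w v N (fun p hp => hb p (h1.trans hp)) (fun p hp => hb' p (h2.trans hp)),
      key _ _ N (fun p hp => mem_vacuum.2 (by omega)) (fun p hp => mem_vacuum.2 (by omega)),
      mul_div_mul_right _ _ hC, ih]

end VanDeLeur

end

/-! ### Bilinear forms on the tensor square, and the operators that commute with `M ⊗ M`. -/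

noncomputable section

namespace VanDeLeur

variable {n : ℕ}

open Maya TensorProduct

/-- The bilinear form on the semi-infinite wedge space with matrix `M`. -/
def bil (M : Op n) : Fock n →ₗ[ℂ] Module.Dual ℂ (Fock n) :=
  Finsupp.linearCombination ℂ fun w => Finsupp.linearCombination ℂ (M w)

theorem bil_single (M : Op n) (w v : Maya n) (c d : ℂ) :
    bil M (Finsupp.single w c) (Finsupp.single v d) = c * (d * M w v) := by
  simp [bil]

/-- The bilinear form on the tensor square of the semi-infinite wedge space with matrix `M ⊗ M`. -/
def bil2 (M : Op n) : Fock n ⊗[ℂ] Fock n →ₗ[ℂ] Module.Dual ℂ (Fock n ⊗[ℂ] Fock n) :=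
  TensorProduct.dualDistrib ℂ (Fock n) (Fock n) ∘ₗ TensorProduct.map (bil M) (bil M)

theorem bil2_tmul (M : Op n) (a a' b b' : Fock n) :
    bil2 M (a ⊗ₜ a') (b ⊗ₜ b') = bil M a b * bil M a' b' := by
  simp [bil2]

open Classical in
/-- The identity operator. -/
def idOp : Op n := fun w v => if w = v then 1 else 0

theorem bil_idOp_single_left (w : Maya n) (b : Fock n) :
    bil idOp (Finsupp.single w 1) b = b w := by
  classical
  induction b using Finsupp.induction_linear with
  | zero => simp
  | add f g hf hg => simp [hf, hg]
  | single v c =>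
    rw [bil_single, Finsupp.single_apply, idOp]
    simp [eq_comm]

theorem bil_idOp_comm (a b : Fock n) : bil idOp a b = bil idOp b a := by
  suffices h : bil (idOp (n := n)) = (bil idOp).flip by
    conv_lhs => rw [h]
    rfl
  ext w v
  simp only [LinearMap.comp_apply, LinearMap.flip_apply, Finsupp.lsingle_apply, bil_single, idOp]
  by_cases h : w = v
  · rw [h]
  · rw [if_neg h, if_neg (Ne.symm h)]

theorem pairing_eq_bil (a b : Fock n) : pairing a b = bil idOp a b := by
  induction a using Finsupp.induction_linear with
  | zero => simp [pairing]
  | add f g hf hg =>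
    rw [map_add, LinearMap.add_apply, ← hf, ← hg, pairing,
      Finsupp.sum_add_index' (by simp) (by intros; ring)]
    rfl
  | single w c =>
    rw [pairing, Finsupp.sum_single_index (by simp), ← bil_idOp_single_left, ← smul_eq_mul,
      ← LinearMap.smul_apply, ← map_smul, Finsupp.smul_single_one]

theorem bil2_idOp_comm (s t : Fock n ⊗[ℂ] Fock n) : bil2 idOp s t = bil2 idOp t s := by
  induction s using TensorProduct.induction_on with
  | zero => simp
  | add x y hx hy => simp [hx, hy]
  | tmul a a' =>
    induction t using TensorProduct.induction_on with
    | zero => simp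
    | add x y hx hy => simp [hx, hy]
    | tmul b b' => rw [bil2_tmul, bil2_tmul, bil_idOp_comm, bil_idOp_comm a']

theorem bil2_idOp_single (w w' : Maya n) (t : Fock n ⊗[ℂ] Fock n) :
    bil2 idOp (Finsupp.single w 1 ⊗ₜ Finsupp.single w' 1) t =
      finsuppTensorFinsupp' ℂ (Maya n) (Maya n) t (w, w') := by
  induction t using TensorProduct.induction_on with
  | zero => simp
  | add x y hx hy => simp [hx, hy]
  | tmul b b' =>
    rw [bil2_tmul, bil_idOp_single_left, bil_idOp_single_left, finsuppTensorFinsupp'_apply_apply]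

/-- Nondegeneracy: pairing with tensors of basis vectors reads off all coefficients. It turns
identities of forms into identities of operators. -/
theorem eq_of_bil2_idOp_right {t t' : Fock n ⊗[ℂ] Fock n}
    (h : ∀ s, bil2 idOp s t = bil2 idOp s t') : t = t' := by
  apply (finsuppTensorFinsupp' ℂ (Maya n) (Maya n)).injective
  ext ⟨w, w'⟩
  rw [← bil2_idOp_single, ← bil2_idOp_single, h]

theorem eq_of_bil2_idOp_left {s s' : Fock n ⊗[ℂ] Fock n}
    (h : ∀ t, bil2 idOp s t = bil2 idOp s' t) : s = s' :=
  eq_of_bil2_idOp_right fun t => by rw [bil2_idOp_comm, h, bil2_idOp_comm]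

theorem bil2_map_right {M N : Op n} {L : Module.End ℂ (Fock n)}
    (h : ∀ a b, bil N a b = bil M a (L b)) (s t : Fock n ⊗[ℂ] Fock n) :
    bil2 N s t = bil2 M s (TensorProduct.map L L t) := by
  induction s using TensorProduct.induction_on with
  | zero => simp
  | add x y hx hy => simp [hx, hy]
  | tmul a a' =>
    induction t using TensorProduct.induction_on with
    | zero => simp
    | add x y hx hy => simp [hx, hy]
    | tmul b b' => rw [TensorProduct.map_tmul, bil2_tmul, bil2_tmul, h, h]

theorem bil2_map_left {M N : Op n} {R : Module.End ℂ (Fock n)}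
    (h : ∀ a b, bil N a b = bil M (R a) b) (s t : Fock n ⊗[ℂ] Fock n) :
    bil2 N s t = bil2 M (TensorProduct.map R R s) t := by
  induction s using TensorProduct.induction_on with
  | zero => simp
  | add x y hx hy => simp [hx, hy]
  | tmul a a' =>
    induction t using TensorProduct.induction_on with
    | zero => simp
    | add x y hx hy => simp [hx, hy]
    | tmul b b' => rw [TensorProduct.map_tmul, bil2_tmul, bil2_tmul, h, h]

/-- `M ⊗ M` commutes with an operator `Ω` on the tensor square whose transpose is `Ωt`. -/
def Intertwines (Ω Ωt : Module.End ℂ (Fock n ⊗[ℂ] Fock n)) (M : Op n) : Prop :=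
  ∀ s t, bil2 M (Ωt s) t = bil2 M s (Ω t)

theorem intertwines_of_single {Ω Ωt : Module.End ℂ (Fock n ⊗[ℂ] Fock n)} {M : Op n}
    (h : ∀ w w' v v' : Maya n,
      bil2 M (Ωt (Finsupp.single w 1 ⊗ₜ Finsupp.single w' 1))
          (Finsupp.single v 1 ⊗ₜ Finsupp.single v' 1) =
        bil2 M (Finsupp.single w 1 ⊗ₜ Finsupp.single w' 1)
          (Ω (Finsupp.single v 1 ⊗ₜ Finsupp.single v' 1))) : Intertwines Ω Ωt M := by
  suffices H : bil2 M ∘ₗ Ωt = (bil2 M).compl₂ Ω from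
    fun s t => LinearMap.congr_fun (LinearMap.congr_fun H s) t
  ext w w' v v'
  simpa using h w w' v v'

/-- With finite columns `M'` is a genuine endomorphism `L` of `Fock n`, and the product is `M`
precomposed with `L`. In the case of finite rows the transpose of the left factor plays this role.
-/
theorem bil_mul_of_finite_columns {M M' : Op n} (h : ∀ v, {x | M' x v ≠ 0}.Finite) :
    ∃ L : Module.End ℂ (Fock n), (∀ a b, bil M' a b = bil idOp a (L b)) ∧
      ∀ a b, bil (fun w v => ∑ᶠ x, M w x * M' x v) a b = bil M a (L b) := by
  let L : Module.End ℂ (Fock n) :=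
    Finsupp.linearCombination ℂ fun v => Finsupp.ofSupportFinite (fun x => M' x v) (h v)
  refine ⟨L, ?_, ?_⟩
  · suffices H : bil M' = (bil idOp).compl₂ L from
      fun a b => LinearMap.congr_fun (LinearMap.congr_fun H a) b
    ext w v
    simp only [LinearMap.comp_apply, Finsupp.lsingle_apply, bil_single, LinearMap.compl₂_apply, L,
      Finsupp.linearCombination_single, one_smul, one_mul, bil_idOp_single_left]
    rfl
  · suffices H : bil (fun w v => ∑ᶠ x, M w x * M' x v) = (bil M).compl₂ L from
      fun a b => LinearMap.congr_fun (LinearMap.congr_fun H a) b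
    ext w v
    simp only [LinearMap.comp_apply, Finsupp.lsingle_apply, bil_single, LinearMap.compl₂_apply, L,
      Finsupp.linearCombination_single, one_smul, one_mul]
    simp only [bil, Finsupp.linearCombination_single, one_smul]
    rw [Finsupp.linearCombination_apply, Finsupp.sum, finsum_eq_sum_of_support_subset]
    · refine Finset.sum_congr rfl fun x _ => ?_
      rw [smul_eq_mul, mul_comm]
      rfl
    · intro x hx
      simp only [Finset.mem_coe, Finsupp.mem_support_iff]
      exact right_ne_zero_of_mul hx

theorem bil_mul_of_finite_rows {M M' : Op n} (h : ∀ w, {x | M w x ≠ 0}.Finite) :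
    ∃ R : Module.End ℂ (Fock n), (∀ a b, bil M a b = bil idOp (R a) b) ∧
      ∀ a b, bil (fun w v => ∑ᶠ x, M w x * M' x v) a b = bil M' (R a) b := by
  let R : Module.End ℂ (Fock n) :=
    Finsupp.linearCombination ℂ fun w => Finsupp.ofSupportFinite (fun x => M w x) (h w)
  refine ⟨R, ?_, ?_⟩
  · suffices H : bil M = bil idOp ∘ₗ R from
      fun a b => LinearMap.congr_fun (LinearMap.congr_fun H a) b
    ext w v
    simp only [LinearMap.comp_apply, Finsupp.lsingle_apply, bil_single, R,
      Finsupp.linearCombination_single, one_smul, one_mul]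
    rw [bil_idOp_comm, bil_idOp_single_left]
    rfl
  · suffices H : bil (fun w v => ∑ᶠ x, M w x * M' x v) = bil M' ∘ₗ R from
      fun a b => LinearMap.congr_fun (LinearMap.congr_fun H a) b
    ext w v
    simp only [LinearMap.comp_apply, Finsupp.lsingle_apply, bil_single, R,
      Finsupp.linearCombination_single, one_smul, one_mul]
    rw [bil, Finsupp.linearCombination_apply, Finsupp.sum, LinearMap.sum_apply,
      finsum_eq_sum_of_support_subset]
    · refine Finset.sum_congr rfl fun x _ => ?_
      simp only [LinearMap.smul_apply, Finsupp.linearCombination_single, smul_eq_mul, one_mul]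
      rfl
    · intro x hx
      simp only [Finset.mem_coe, Finsupp.mem_support_iff]
      exact left_ne_zero_of_mul hx

/-- The factor that is a genuine endomorphism, or has one as its transpose, has a tensor square that
commutes with `Ω`, respectively `Ωt`, because `idOp` intertwines and the pairing is nondegenerate.
It can then be moved past `Ω` or `Ωt` and the other factor treated alone. -/
theorem Intertwines.mul {Ω Ωt : Module.End ℂ (Fock n ⊗[ℂ] Fock n)} {M M' : Op n}
    (hid : Intertwines Ω Ωt idOp) (hM : Intertwines Ω Ωt M) (hM' : Intertwines Ω Ωt M')
    (hfin : (∀ w, {x | M w x ≠ 0}.Finite) ∨ (∀ v, {x | M' x v ≠ 0}.Finite)) :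
    Intertwines Ω Ωt (fun w v => ∑ᶠ x, M w x * M' x v) := by
  intro s t
  rcases hfin with h | h
  · obtain ⟨R, h1, h2⟩ := bil_mul_of_finite_rows (M' := M') h
    have hR : TensorProduct.map R R (Ωt s) = Ωt (TensorProduct.map R R s) := by
      refine eq_of_bil2_idOp_left fun t => ?_
      rw [← bil2_map_left h1, hM, bil2_map_left h1, hid]
    rw [bil2_map_left h2, hR, hM', bil2_map_left h2]
  · obtain ⟨L, h1, h2⟩ := bil_mul_of_finite_columns (M := M) h
    have hL : TensorProduct.map L L (Ω t) = Ω (TensorProduct.map L L t) := by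
      refine eq_of_bil2_idOp_right fun s => ?_
      rw [← bil2_map_right h1, ← hM', bil2_map_right h1, hid]
    rw [bil2_map_right h2, bil2_map_right h2, hL, hM]

/-- Local finiteness of the sum `∑ p, X p ⊗ Y p`. -/
def IsLocallyFinite (X Y : Mode n → Module.End ℂ (Fock n)) : Prop :=
  ∀ f g, (Function.support fun p => X p f ⊗ₜ[ℂ] Y p g).Finite

/-- The operator `∑ p, X p ⊗ Y p`. -/
def pairOp (X Y : Mode n → Module.End ℂ (Fock n)) (h : IsLocallyFinite X Y) :
    Module.End ℂ (Fock n ⊗[ℂ] Fock n) :=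
  TensorProduct.lift <| LinearMap.mk₂ ℂ (fun f g => ∑ᶠ p, X p f ⊗ₜ[ℂ] Y p g)
    (fun f f' g => by
      simp only [map_add, TensorProduct.add_tmul]
      exact finsum_add_distrib (h f g) (h f' g))
    (fun c f g => by
      simp only [map_smul, ← TensorProduct.smul_tmul']
      exact (smul_finsum' c (h f g)).symm)
    (fun f g g' => by
      simp only [map_add, TensorProduct.tmul_add]
      exact finsum_add_distrib (h f g) (h f g'))
    (fun c f g => by
      simp only [map_smul, TensorProduct.tmul_smul]
      exact (smul_finsum' c (h f g)).symm)

theorem pairOp_tmul {X Y : Mode n → Module.End ℂ (Fock n)} (h : IsLocallyFinite X Y)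
    (f g : Fock n) : pairOp X Y h (f ⊗ₜ g) = ∑ᶠ p, X p f ⊗ₜ[ℂ] Y p g := rfl

theorem bil2_pairOp_right {X Y : Mode n → Module.End ℂ (Fock n)} (h : IsLocallyFinite X Y)
    (M : Op n) (a a' f g : Fock n) :
    bil2 M (a ⊗ₜ a') (pairOp X Y h (f ⊗ₜ g)) = ∑ᶠ p, bil M a (X p f) * bil M a' (Y p g) := by
  rw [pairOp_tmul, map_finsum _ (h f g)]
  simp only [bil2_tmul]

theorem bil2_pairOp_left {X Y : Mode n → Module.End ℂ (Fock n)} (h : IsLocallyFinite X Y)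
    (M : Op n) (a a' f g : Fock n) :
    bil2 M (pairOp X Y h (a ⊗ₜ a')) (f ⊗ₜ g) = ∑ᶠ p, bil M (X p a) f * bil M (Y p a') g := by
  rw [pairOp_tmul, map_finsum _ (h a a'),
    show ∀ φ : Module.Dual ℂ (Fock n ⊗[ℂ] Fock n), φ (f ⊗ₜ g) =
      Module.Dual.eval ℂ _ (f ⊗ₜ g) φ from fun _ => rfl,
    map_finsum]
  · simp only [Module.Dual.eval_apply, bil2_tmul]
  · exact (h a a').subset (Function.support_comp_subset (map_zero _) _)

/-- `Xt` is the transpose of `X`. -/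
def IsTranspose (X Xt : Module.End ℂ (Fock n)) : Prop :=
  ∀ a b, bil idOp (Xt a) b = bil idOp a (X b)

theorem IsTranspose.symm {X Xt : Module.End ℂ (Fock n)} (h : IsTranspose X Xt) :
    IsTranspose Xt X := fun a b => by rw [bil_idOp_comm, ← h, bil_idOp_comm]

theorem IsTranspose.mul {X Xt Y Yt : Module.End ℂ (Fock n)} (hX : IsTranspose X Xt)
    (hY : IsTranspose Y Yt) : IsTranspose (X * Y) (Yt * Xt) := fun a b => by
  rw [Module.End.mul_apply, Module.End.mul_apply, hY, hX]

theorem IsTranspose.smul {X Xt : Module.End ℂ (Fock n)} (hX : IsTranspose X Xt) (c : ℂ) :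
    IsTranspose (c • X) (c • Xt) := fun a b => by
  simp [hX a b]

theorem isTranspose_one : IsTranspose (1 : Module.End ℂ (Fock n)) 1 := fun _ _ => rfl

theorem isTranspose_wedge (p : Mode n) : IsTranspose (wedge p) (contract p) := by
  classical
  suffices H : bil idOp ∘ₗ contract p = (bil idOp).compl₂ (wedge p) from
    fun a b => LinearMap.congr_fun (LinearMap.congr_fun H a) b
  ext w v
  simp only [LinearMap.comp_apply, Finsupp.lsingle_apply, LinearMap.compl₂_apply, wedge_single,
    contract_single, one_mul]
  by_cases hw : p ∈ w.carrier <;> by_cases hv : p ∈ v.carrier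
  · rw [if_pos hw, if_pos hv, map_zero, bil_single, idOp, if_neg]
    · simp
    · rintro rfl
      exact hv.2 rfl
  · rw [if_pos hw, if_neg hv, bil_single, bil_single, idOp, idOp]
    by_cases h : w = v.insert p
    · subst h
      rw [erase_insert hv, if_pos rfl, if_pos rfl, sign_insert hv]
      simp
    · rw [if_neg h, if_neg]
      · simp
      · rintro rfl
        exact h (insert_erase hw).symm
  · rw [if_neg hw, if_pos hv]
    simp
  · rw [if_neg hw, if_neg hv, map_zero, LinearMap.zero_apply, bil_single, idOp, if_neg]
    · simp
    · rintro rfl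
      exact hw (Or.inl rfl)

theorem intertwines_idOp {X Y Xt Yt : Mode n → Module.End ℂ (Fock n)}
    (h : IsLocallyFinite X Y) (ht : IsLocallyFinite Xt Yt)
    (hX : ∀ p, IsTranspose (X p) (Xt p)) (hY : ∀ p, IsTranspose (Y p) (Yt p)) :
    Intertwines (pairOp X Y h) (pairOp Xt Yt ht) idOp := by
  refine intertwines_of_single fun w w' v v' => ?_
  rw [bil2_pairOp_left, bil2_pairOp_right]
  exact finsum_congr fun p => by rw [hX p, hY p]

/-- The dual basis vector `e_i z^(-1-d)` of `e_i z^d` with respect to the symplectic form. -/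
def dualMode (p : Mode n) : Mode n := mode (idx p) (-1 - deg p)

/-- The coefficient `(-1)^d` of the symplectic form. -/
def modeParity (p : Mode n) : ℂ := (-1) ^ deg p

theorem deg_dualMode (p : Mode n) : deg (dualMode p) = -1 - deg p := rfl

theorem idx_dualMode (p : Mode n) : idx (dualMode p) = idx p := rfl

theorem dualMode_dualMode (p : Mode n) : dualMode (dualMode p) = p := by
  unfold dualMode
  rw [deg_mode, idx_mode, sub_sub_cancel]
  rfl

theorem isLocallyFinite_wedge_contract :
    IsLocallyFinite (n := n) wedge contract := by
  intro f g
  obtain ⟨b, hb⟩ := exists_wedge_eq_zero f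
  obtain ⟨a, ha⟩ := exists_contract_eq_zero g
  refine (finite_deg_mem_Icc a b).subset fun p hp => ⟨?_, ?_⟩ <;> by_contra! h <;> apply hp
  · simp [ha p h]
  · simp [hb p h.le]

theorem isLocallyFinite_contract_wedge :
    IsLocallyFinite (n := n) contract wedge := by
  intro f g
  obtain ⟨b, hb⟩ := exists_wedge_eq_zero g
  obtain ⟨a, ha⟩ := exists_contract_eq_zero f
  refine (finite_deg_mem_Icc a b).subset fun p hp => ⟨?_, ?_⟩ <;> by_contra! h <;> apply hp
  · simp [ha p h]
  · simp [hb p h.le]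

/-- `dualMode` reverses the degree, so high degrees are killed by the first factor and low degrees
by the second. -/
theorem isLocallyFinite_wedge_wedge :
    IsLocallyFinite (n := n) wedge fun p => modeParity p • wedge (dualMode p) := by
  intro f g
  obtain ⟨b, hb⟩ := exists_wedge_eq_zero f
  obtain ⟨b', hb'⟩ := exists_wedge_eq_zero g
  refine (finite_deg_mem_Icc (-1 - b') b).subset fun p hp => ⟨?_, ?_⟩ <;> by_contra! h <;> apply hp
  · simp [hb' (dualMode p) (by rw [deg_dualMode]; omega)]
  · simp [hb p h.le]

theorem isLocallyFinite_contract_contract :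
    IsLocallyFinite (n := n) contract fun p => modeParity p • contract (dualMode p) := by
  intro f g
  obtain ⟨b, hb⟩ := exists_contract_eq_zero f
  obtain ⟨b', hb'⟩ := exists_contract_eq_zero g
  refine (finite_deg_mem_Icc b (-1 - b')).subset fun p hp => ⟨?_, ?_⟩ <;> by_contra! h <;> apply hp
  · simp [hb p h]
  · simp [hb' (dualMode p) (by rw [deg_dualMode]; omega)]

/-- The operator `∑ p, p ∧ ⊗ ∂_p`, which commutes with the action of every matrix. -/
def bilinearOp : Module.End ℂ (Fock n ⊗[ℂ] Fock n) :=
  pairOp wedge contract isLocallyFinite_wedge_contract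

/-- The transpose of `bilinearOp`. -/
def bilinearOpT : Module.End ℂ (Fock n ⊗[ℂ] Fock n) :=
  pairOp contract wedge isLocallyFinite_contract_wedge

/-- The operator `∑ p, ± p ∧ ⊗ p* ∧`, which commutes with the action of symplectic matrices. -/
def symplecticOp : Module.End ℂ (Fock n ⊗[ℂ] Fock n) :=
  pairOp wedge (fun p => modeParity p • wedge (dualMode p)) isLocallyFinite_wedge_wedge

/-- The transpose of `symplecticOp`. -/
def symplecticOpT : Module.End ℂ (Fock n ⊗[ℂ] Fock n) :=
  pairOp contract (fun p => modeParity p • contract (dualMode p)) isLocallyFinite_contract_contract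

theorem intertwines_bilinearOp_idOp : Intertwines (n := n) bilinearOp bilinearOpT idOp :=
  intertwines_idOp _ _ isTranspose_wedge fun p => (isTranspose_wedge p).symm

theorem intertwines_symplecticOp_idOp : Intertwines (n := n) symplecticOp symplecticOpT idOp :=
  intertwines_idOp _ _ isTranspose_wedge fun _ => (isTranspose_wedge _).smul _

end VanDeLeur

end

/-! ### From truncated minors to the semi-infinite wedge space. -/

noncomputable section

namespace VanDeLeur

variable {n : ℕ}

open Maya TensorProduct Filter

/-- A discrete form of dominated convergence: a fixed finite set carries every contribution, and on
it each term is eventually constant. -/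
theorem eventually_sum_eq_finsum {ι : Type*} {S : ℕ → Finset ι} {t : ℕ → ι → ℂ} {u : ι → ℂ}
    {F : Set ι} (hF : F.Finite) (hu : ∀ p ∉ F, u p = 0) (hS : ∀ᶠ N in atTop, F ⊆ S N)
    (ht : ∀ᶠ N in atTop, ∀ p ∈ S N, p ∉ F → t N p = 0)
    (htu : ∀ p ∈ F, ∀ᶠ N in atTop, t N p = u p) :
    ∀ᶠ N in atTop, ∑ p ∈ S N, t N p = ∑ᶠ p, u p := by
  have htu' := (eventually_all_finite hF).2 htu
  filter_upwards [hS, ht, htu'] with N h1 h2 h3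
  have hsub : hF.toFinset ⊆ S N := fun p hp => h1 (hF.mem_toFinset.1 hp)
  rw [finsum_eq_sum_of_support_subset u (s := hF.toFinset),
    ← Finset.sum_subset hsub fun p hp hpF => h2 p hp fun h => hpF (hF.mem_toFinset.2 h)]
  · exact Finset.sum_congr rfl fun p hp => h3 p (hF.mem_toFinset.1 hp)
  · intro p hp
    rw [hF.coe_toFinset]
    by_contra h
    exact hp (hu p h)

theorem eventually_deg_lt (p : Mode n) : ∀ᶠ N : ℕ in atTop, deg p < N := by
  filter_upwards [eventually_gt_atTop (deg p).toNat] with N hN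
  omega

theorem eventually_subset_below {v : Maya n} {F : Set (Mode n)} (hF : F.Finite)
    (hv : F ⊆ v.carrier) : ∀ᶠ N in atTop, F ⊆ v.below N := by
  have := (eventually_all_finite hF).2 fun p _ => eventually_deg_lt p
  filter_upwards [this] with N hN p hp
  exact mem_below.2 ⟨hv hp, hN p hp⟩

/-- The truncation of the vacuum minor. -/
def vacuumMinor (T : Mode n → Mode n → ℂ) (N : ℕ) : ℂ :=
  minor T ((vacuum : Maya n).below N) ((vacuum : Maya n).below N)

namespace IsStable

variable {T : Mode n → Mode n → ℂ}

/-- This and the next three lemmas identify the normalized terms of the minor identities, for large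
`N`, with matrix elements of `groupOp T` in which one mode is added or removed. -/
theorem eventually_contract_left (hT : IsStable T) (p : Mode n) (w v : Maya n) :
    ∀ᶠ N in atTop, (if p ∈ w.below N then finsetSign p (w.below N) *
        minor T ((w.below N).erase p) (v.below N) else 0) / vacuumMinor T N =
      bil (groupOp T) (contract p (Finsupp.single w 1)) (Finsupp.single v 1) := by
  filter_upwards [eventually_deg_lt p, hT.eventually_eq (w.erase p) v] with N hN h
  rw [contract_single]
  by_cases hp : p ∈ w.carrier
  · rw [if_pos (mem_below.2 ⟨hp, hN⟩), if_pos hp, bil_single, ← h, below_erase,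
      finsetSign_below w hN, mul_div_assoc, one_mul, one_mul]
    rfl
  · rw [if_neg fun h => hp (mem_below.1 h).1, if_neg hp]
    simp

theorem eventually_wedge_left (hT : IsStable T) (p : Mode n) (w v : Maya n) :
    ∀ᶠ N in atTop, (if p ∈ w.below N then 0 else finsetSign p (w.below N) *
        minor T (Insert.insert p (w.below N)) (v.below N)) / vacuumMinor T N =
      bil (groupOp T) (wedge p (Finsupp.single w 1)) (Finsupp.single v 1) := by
  filter_upwards [eventually_deg_lt p, hT.eventually_eq (w.insert p) v] with N hN h
  rw [wedge_single]
  by_cases hp : p ∈ w.carrier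
  · rw [if_pos (mem_below.2 ⟨hp, hN⟩), if_pos hp]
    simp
  · rw [if_neg fun h => hp (mem_below.1 h).1, if_neg hp, bil_single, ← h, below_insert hN,
      finsetSign_below w hN, mul_div_assoc, one_mul, one_mul]
    rfl

theorem eventually_contract_right (hT : IsStable T) (p : Mode n) (w v : Maya n) :
    ∀ᶠ N in atTop, (if p ∈ v.below N then finsetSign p (v.below N) *
        minor T (w.below N) ((v.below N).erase p) else 0) / vacuumMinor T N =
      bil (groupOp T) (Finsupp.single w 1) (contract p (Finsupp.single v 1)) := by
  filter_upwards [eventually_deg_lt p, hT.eventually_eq w (v.erase p)] with N hN h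
  rw [contract_single]
  by_cases hp : p ∈ v.carrier
  · rw [if_pos (mem_below.2 ⟨hp, hN⟩), if_pos hp, bil_single, ← h, below_erase,
      finsetSign_below v hN, mul_div_assoc, one_mul, one_mul]
    rfl
  · rw [if_neg fun h => hp (mem_below.1 h).1, if_neg hp]
    simp

theorem eventually_wedge_right (hT : IsStable T) (p : Mode n) (w v : Maya n) :
    ∀ᶠ N in atTop, (if p ∈ v.below N then 0 else finsetSign p (v.below N) *
        minor T (w.below N) (Insert.insert p (v.below N))) / vacuumMinor T N =
      bil (groupOp T) (Finsupp.single w 1) (wedge p (Finsupp.single v 1)) := by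
  filter_upwards [eventually_deg_lt p, hT.eventually_eq w (v.insert p)] with N hN h
  rw [wedge_single]
  by_cases hp : p ∈ v.carrier
  · rw [if_pos (mem_below.2 ⟨hp, hN⟩), if_pos hp]
    simp
  · rw [if_neg fun h => hp (mem_below.1 h).1, if_neg hp, bil_single, ← h, below_insert hN,
      finsetSign_below v hN, mul_div_assoc, one_mul, one_mul]
    rfl

end IsStable

theorem finite_mem_notMem (v w : Maya n) : {p | p ∈ v.carrier ∧ p ∉ w.carrier}.Finite := by
  obtain ⟨a, ha⟩ := v.bounded_below
  obtain ⟨b, hb⟩ := w.tail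
  refine (finite_deg_mem_Icc a b).subset fun p hp => ⟨ha p hp.1, ?_⟩
  by_contra! h
  exact hp.2 (hb p h.le)

theorem finite_mem_dualMode_mem (v w : Maya n) :
    {p | p ∈ v.carrier ∧ dualMode p ∈ w.carrier}.Finite := by
  obtain ⟨a, ha⟩ := v.bounded_below
  obtain ⟨b, hb⟩ := w.bounded_below
  refine (finite_deg_mem_Icc a (-1 - b)).subset fun p hp => ⟨ha p hp.1, ?_⟩
  have := hb _ hp.2
  rw [deg_dualMode] at this
  omega

theorem finite_notMem_dualMode_notMem (v w : Maya n) :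
    {p | p ∉ v.carrier ∧ dualMode p ∉ w.carrier}.Finite := by
  obtain ⟨a, ha⟩ := v.tail
  obtain ⟨b, hb⟩ := w.tail
  refine (finite_deg_mem_Icc (-1 - b) a).subset fun p hp => ⟨?_, ?_⟩
  · by_contra! h
    exact hp.2 (hb _ (by rw [deg_dualMode]; omega))
  · by_contra! h
    exact hp.1 (ha _ h.le)

/-- Both sides have finitely many contributing modes, so at a large truncation they equal finite
sums of quotients of minors. There the claim is `minor_bilinear` divided by the square of the vacuum
minor. -/
theorem intertwines_bilinearOp_groupOp {T : Mode n → Mode n → ℂ} (hT : IsStable T) :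
    Intertwines bilinearOp bilinearOpT (groupOp T) := by
  refine intertwines_of_single fun w w' v v' => ?_
  rw [bilinearOp, bilinearOpT, bil2_pairOp_left, bil2_pairOp_right]
  have hl : ∀ᶠ N in atTop, ∑ p ∈ w.below N,
      ((if p ∈ w.below N then finsetSign p (w.below N) *
        minor T ((w.below N).erase p) (v.below N) else 0) / vacuumMinor T N) *
      ((if p ∈ w'.below N then 0 else finsetSign p (w'.below N) *
        minor T (Insert.insert p (w'.below N)) (v'.below N)) / vacuumMinor T N) = _ :=
    eventually_sum_eq_finsum
      (u := fun p => bil (groupOp T) (contract p (Finsupp.single w 1)) (Finsupp.single v 1) *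
        bil (groupOp T) (wedge p (Finsupp.single w' 1)) (Finsupp.single v' 1))
      (finite_mem_notMem w w')
      (fun p hp => by
        rw [contract_single, wedge_single]
        rcases not_and_or.1 hp with h | h
        · simp [h]
        · simp [not_not.1 h])
      (eventually_subset_below (finite_mem_notMem w w') fun p hp => hp.1)
      (Eventually.of_forall fun N p hp h => by
        have hp' := mem_below.1 hp
        have : p ∈ w'.below N := mem_below.2 ⟨by_contra fun h' => h ⟨hp'.1, h'⟩, hp'.2⟩
        simp [this])
      (fun p _ => by
        filter_upwards [hT.eventually_contract_left p w v, hT.eventually_wedge_left p w' v']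
          with N h1 h2
        rw [h1, h2])
  have hr : ∀ᶠ N in atTop, ∑ p ∈ v'.below N,
      ((if p ∈ v.below N then 0 else finsetSign p (v.below N) *
        minor T (w.below N) (Insert.insert p (v.below N))) / vacuumMinor T N) *
      ((if p ∈ v'.below N then finsetSign p (v'.below N) *
        minor T (w'.below N) ((v'.below N).erase p) else 0) / vacuumMinor T N) = _ :=
    eventually_sum_eq_finsum
      (u := fun p => bil (groupOp T) (Finsupp.single w 1) (wedge p (Finsupp.single v 1)) *
        bil (groupOp T) (Finsupp.single w' 1) (contract p (Finsupp.single v' 1)))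
      (finite_mem_notMem v' v)
      (fun p hp => by
        rw [contract_single, wedge_single]
        rcases not_and_or.1 hp with h | h
        · simp [h]
        · simp [not_not.1 h])
      (eventually_subset_below (finite_mem_notMem v' v) fun p hp => hp.1)
      (Eventually.of_forall fun N p hp h => by
        have hp' := mem_below.1 hp
        have : p ∈ v.below N := mem_below.2 ⟨by_contra fun h' => h ⟨hp'.1, h'⟩, hp'.2⟩
        simp [this])
      (fun p _ => by
        filter_upwards [hT.eventually_contract_right p w' v', hT.eventually_wedge_right p w v]
          with N h1 h2
        rw [h1, h2])
  obtain ⟨N, h1, h2⟩ := (hl.and hr).exists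
  rw [← h1, ← h2]
  have := minor_bilinear T (w.below N) (w'.below N) (v.below N) (v'.below N)
  simp only [div_mul_div_comm, ← Finset.sum_div]
  congr 1
  rw [Finset.sum_congr rfl fun p hp => by rw [if_pos hp], ← this]
  exact Finset.sum_congr rfl fun p hp => by rw [if_pos hp]

/-! ### The symplectic form: invariance of minors, and the series that preserve it. -/

/-- The basis vectors `e_i z^d` with `-N ≤ d < N`. -/
def window (n N : ℕ) : Finset (Mode n) :=
  (Finset.Ico (-(N : ℤ)) N ×ˢ (Finset.univ : Finset (Fin n))).map toLex.toEmbedding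

theorem mem_window {N : ℕ} {p : Mode n} : p ∈ window n N ↔ -(N : ℤ) ≤ deg p ∧ deg p < N := by
  simp only [window, Finset.mem_map, Finset.mem_product, Finset.mem_Ico, Finset.mem_univ, and_true]
  constructor
  · rintro ⟨x, hx, rfl⟩
    exact hx
  · intro h
    exact ⟨ofLex p, h, rfl⟩

theorem sum_window (N : ℕ) (F : Mode n → ℂ) :
    ∑ p ∈ window n N, F p = ∑ d ∈ Finset.Ico (-(N : ℤ)) N, ∑ i, F (mode i d) := by
  rw [window, Finset.sum_map, Finset.sum_product]
  rfl

/-- The matrix `T`, truncated to large windows, preserves the symplectic form. -/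
def IsFormPreserving (T : Mode n → Mode n → ℂ) : Prop :=
  ∀ (N : ℕ), ∀ r ∈ window n N, ∀ r' ∈ window n N,
    ∑ p ∈ window n N, modeParity p * (T r p * T r' (dualMode p)) =
      if r' = dualMode r then modeParity r else 0

/-- The bilinear relation between minors that expresses the invariance of the symplectic form. -/
theorem minor_symplectic {T : Mode n → Mode n → ℂ} (hT : IsFormPreserving T) (N : ℕ)
    {P P' : Finset (Mode n)} (Q Q' : Finset (Mode n)) (hP : P ⊆ window n N)
    (hP' : P' ⊆ window n N) :
    ∑ p ∈ window n N, (if p ∈ Q then 0 else finsetSign p Q * minor T P (insert p Q)) *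
        (modeParity p * if dualMode p ∈ Q' then 0 else
          finsetSign (dualMode p) Q' * minor T P' (insert (dualMode p) Q')) =
      ∑ r ∈ P, (finsetSign r P * minor T (P.erase r) Q) *
        (modeParity r * if dualMode r ∈ P' then
          finsetSign (dualMode r) P' * minor T (P'.erase (dualMode r)) Q' else 0) := by
  simp only [minor_expand_column]
  rw [Finset.sum_congr rfl fun p _ => by rw [Finset.mul_sum, Finset.sum_mul_sum], Finset.sum_comm]
  refine Finset.sum_congr rfl fun r hr => ?_
  rw [Finset.sum_comm]
  -- After expanding both minors, the sum over `p` only involves `T r p * T r' (dualMode p)`.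
  -- Preservation of the form leaves just `r' = dualMode r`.
  have key : ∀ r' ∈ P', ∑ p ∈ window n N, finsetSign r P * T r p * minor T (P.erase r) Q *
      (modeParity p * (finsetSign r' P' * T r' (dualMode p) * minor T (P'.erase r') Q')) =
      if dualMode r = r' then finsetSign r P * minor T (P.erase r) Q *
        (modeParity r * (finsetSign r' P' * minor T (P'.erase r') Q')) else 0 := by
    intro r' hr'
    have := hT N r (hP hr) r' (hP' hr')
    calc _ = (∑ p ∈ window n N, modeParity p * (T r p * T r' (dualMode p))) *
          (finsetSign r P * minor T (P.erase r) Q *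
            (finsetSign r' P' * minor T (P'.erase r') Q')) := by
          rw [Finset.sum_mul]
          exact Finset.sum_congr rfl fun p _ => by ring
      _ = _ := by
          rw [this]
          by_cases h : r' = dualMode r
          · rw [if_pos h, if_pos h.symm]
            ring
          · rw [if_neg h, if_neg (Ne.symm h), zero_mul]
  rw [Finset.sum_congr rfl key, Finset.sum_ite_eq]
  split_ifs <;> simp

theorem eventually_below_subset_window (v : Maya n) :
    ∀ᶠ N in atTop, v.below N ⊆ window n N := by
  obtain ⟨a, ha⟩ := v.bounded_below
  filter_upwards [eventually_ge_atTop (-a).toNat] with N hN p hp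
  obtain ⟨h1, h2⟩ := mem_below.1 hp
  have := ha p h1
  exact mem_window.2 ⟨by omega, h2⟩

theorem intertwines_symplecticOp_groupOp {T : Mode n → Mode n → ℂ} (hT : IsStable T)
    (hform : IsFormPreserving T) :
    Intertwines symplecticOp symplecticOpT (groupOp T) := by
  refine intertwines_of_single fun w w' v v' => ?_
  rw [symplecticOp, symplecticOpT, bil2_pairOp_left, bil2_pairOp_right]
  simp only [LinearMap.smul_apply, map_smul, smul_eq_mul]
  have hl : ∀ᶠ N in atTop, ∑ p ∈ w.below N,
      ((if p ∈ w.below N then finsetSign p (w.below N) *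
        minor T ((w.below N).erase p) (v.below N) else 0) / vacuumMinor T N) *
      (modeParity p * ((if dualMode p ∈ w'.below N then finsetSign (dualMode p) (w'.below N) *
        minor T ((w'.below N).erase (dualMode p)) (v'.below N) else 0) / vacuumMinor T N)) = _ :=
    eventually_sum_eq_finsum
      (u := fun p => bil (groupOp T) (contract p (Finsupp.single w 1)) (Finsupp.single v 1) *
        (modeParity p *
          bil (groupOp T) (contract (dualMode p) (Finsupp.single w' 1)) (Finsupp.single v' 1)))
      (finite_mem_dualMode_mem w w')
      (fun p hp => by
        rw [contract_single, contract_single]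
        rcases not_and_or.1 hp with h | h <;> simp [h])
      (eventually_subset_below (finite_mem_dualMode_mem w w') fun p hp => hp.1)
      (Eventually.of_forall fun N p hp h => by
        have hp' := mem_below.1 hp
        have : dualMode p ∉ w'.below N := fun h' => h ⟨hp'.1, (mem_below.1 h').1⟩
        simp [this])
      (fun p _ => by
        filter_upwards [hT.eventually_contract_left p w v,
          hT.eventually_contract_left (dualMode p) w' v'] with N h1 h2
        rw [h1, h2])
  have hr : ∀ᶠ N in atTop, ∑ p ∈ window n N,
      ((if p ∈ v.below N then 0 else finsetSign p (v.below N) *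
        minor T (w.below N) (Insert.insert p (v.below N))) / vacuumMinor T N) *
      (modeParity p * ((if dualMode p ∈ v'.below N then 0 else
        finsetSign (dualMode p) (v'.below N) *
          minor T (w'.below N) (Insert.insert (dualMode p) (v'.below N))) / vacuumMinor T N)) = _ :=
    eventually_sum_eq_finsum
      (u := fun p => bil (groupOp T) (Finsupp.single w 1) (wedge p (Finsupp.single v 1)) *
        (modeParity p *
          bil (groupOp T) (Finsupp.single w' 1) (wedge (dualMode p) (Finsupp.single v' 1))))
      (finite_notMem_dualMode_notMem v v')
      (fun p hp => by
        rw [wedge_single, wedge_single]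
        rcases not_and_or.1 hp with h | h <;> simp [not_not.1 h])
      (by
        filter_upwards [(eventually_all_finite (finite_notMem_dualMode_notMem v v')).2
          fun p _ => eventually_deg_lt p,
          (eventually_all_finite (finite_notMem_dualMode_notMem v v')).2
          fun p _ => eventually_deg_lt (dualMode p)] with N h1 h2 p hp
        have h3 := h2 p hp
        rw [deg_dualMode] at h3
        exact mem_window.2 ⟨by omega, h1 p hp⟩)
      -- The window `-N ≤ d < N` is stable under `d ↦ -1 - d`. Hence a mode outside the finite set
      -- has itself in `v.below N` or its dual in `v'.below N`, and one factor vanishes.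
      (Eventually.of_forall fun N p hp h => by
        obtain ⟨h1, h2⟩ := mem_window.1 hp
        rcases not_and_or.1 h with h | h
        · simp [mem_below.2 ⟨not_not.1 h, h2⟩]
        · have : dualMode p ∈ v'.below N :=
            mem_below.2 ⟨not_not.1 h, by rw [deg_dualMode]; omega⟩
          simp [this])
      (fun p _ => by
        filter_upwards [hT.eventually_wedge_right p w v,
          hT.eventually_wedge_right (dualMode p) w' v'] with N h1 h2
        rw [h1, h2])
  obtain ⟨N, ⟨h1, h2⟩, h3, h4⟩ := ((hl.and hr).and ((eventually_below_subset_window w).and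
    (eventually_below_subset_window w'))).exists
  rw [← h1, ← h2]
  have := minor_symplectic hform N (v.below N) (v'.below N) h3 h4
  simp only [← mul_div_assoc, div_mul_eq_mul_div, div_div, ← Finset.sum_div]
  congr 1
  rw [this]
  exact Finset.sum_congr rfl fun p hp => by rw [if_pos hp]

/-- A one-sided inverse of a square matrix over the commutative ring `PowerSeries ℂ` is two-sided,
so `B(z) B^t(-z) = 1` as well. The form on rows needs this order of the factors. -/
theorem IsSymplecticSeries.right {B : ℕ → Matrix (Fin n) (Fin n) ℂ} (hB : IsSymplecticSeries B)
    (m : ℕ) : ∑ p ∈ Finset.HasAntidiagonal.antidiagonal m,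
      (-1 : ℂ) ^ p.1 • (B p.1 * (B p.2).transpose) = if m = 0 then 1 else 0 := by
  let X : Matrix (Fin n) (Fin n) (PowerSeries ℂ) :=
    Matrix.of fun i j => PowerSeries.mk fun k => (-1) ^ k * B k j i
  let Y : Matrix (Fin n) (Fin n) (PowerSeries ℂ) :=
    Matrix.of fun i j => PowerSeries.mk fun k => B k i j
  have hone : ∀ (m : ℕ) (i j : Fin n), PowerSeries.coeff m
      ((1 : Matrix (Fin n) (Fin n) (PowerSeries ℂ)) i j) =
      (if m = 0 then (1 : Matrix (Fin n) (Fin n) ℂ) else 0) i j := by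
    intro m i j
    by_cases hm : m = 0 <;> by_cases hij : i = j <;>
      simp [Matrix.one_apply, PowerSeries.coeff_one, hm, hij]
  have hXY : X * Y = 1 := by
    ext i j m
    rw [hone, ← hB m, Matrix.mul_apply, map_sum, Matrix.sum_apply]
    simp only [PowerSeries.coeff_mul, X, Y, Matrix.of_apply, PowerSeries.coeff_mk]
    rw [Finset.sum_comm]
    refine Finset.sum_congr rfl fun p _ => ?_
    simp only [Matrix.smul_apply, Matrix.mul_apply, Matrix.transpose_apply, smul_eq_mul,
      Finset.mul_sum, mul_assoc]
  have hYX : Y * X = 1 := mul_eq_one_comm.1 hXY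
  have hsq : ∀ k : ℕ, ((-1 : ℂ) ^ k) * (-1) ^ k = 1 := fun k => by
    rw [← mul_pow]
    simp
  ext i j
  -- The product `Y * X` carries the sign `(-1)^p.2`; multiplying by `(-1)^m` with `p.1 + p.2 = m`
  -- turns it into `(-1)^p.1`.
  have h := congrArg (fun Z : Matrix (Fin n) (Fin n) (PowerSeries ℂ) =>
    (-1 : ℂ) ^ m * PowerSeries.coeff m (Z i j)) hYX
  simp only [hone, Matrix.mul_apply, map_sum, PowerSeries.coeff_mul, X, Y, Matrix.of_apply,
    PowerSeries.coeff_mk] at h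
  rw [Finset.sum_comm, Finset.mul_sum] at h
  rw [Matrix.sum_apply]
  have hr : (-1 : ℂ) ^ m * (if m = 0 then (1 : Matrix (Fin n) (Fin n) ℂ) else 0) i j =
      (if m = 0 then (1 : Matrix (Fin n) (Fin n) ℂ) else 0) i j := by
    by_cases hm : m = 0 <;> simp [hm]
  rw [hr] at h
  rw [← h]
  refine Finset.sum_congr rfl fun p hp => ?_
  rw [← Finset.HasAntidiagonal.mem_antidiagonal.1 hp, pow_add, Matrix.smul_apply,
    Matrix.mul_apply, smul_eq_mul, Finset.mul_sum, Finset.mul_sum]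
  refine Finset.sum_congr rfl fun l _ => ?_
  rw [Matrix.transpose_apply,
    show ∀ a b c d : ℂ, a * b * (c * (b * d)) = (b * b) * (a * (c * d)) by intros; ring, hsq,
    one_mul]

theorem IsSymplecticSeries.det_ne_zero {B : ℕ → Matrix (Fin n) (Fin n) ℂ}
    (hB : IsSymplecticSeries B) : (B 0).det ≠ 0 := by
  have h := congrArg Matrix.det (hB 0)
  simp only [Finset.HasAntidiagonal.antidiagonal_zero, Finset.sum_singleton, pow_zero, one_smul,
    Matrix.det_mul, if_true, Matrix.det_one] at h
  exact right_ne_zero_of_mul (h ▸ one_ne_zero)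

/-- Along `deg p = deg r + ε k` the sum becomes `(-1)^(deg r)` times an entry of the coefficient at
`z^m` of `B(-z) B^t(z)`, which vanishes for `m > 0`. The sign `ε` is `-1` for series in `z` and `1`
for series in `z⁻¹`. -/
theorem sum_window_eq {B : ℕ → Matrix (Fin n) (Fin n) ℂ} (hB : IsSymplecticSeries B)
    {T : Mode n → Mode n → ℂ} {N m : ℕ} {r r' : Mode n} {ε : ℤ} (hε : ε = 1 ∨ ε = -1)
    (hwin : ∀ k : ℕ, k ≤ m → -(N : ℤ) ≤ deg r + ε * k ∧ deg r + ε * k < N)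
    (hzero : ∀ (d : ℤ) (i : Fin n), (∀ k : ℕ, k ≤ m → d ≠ deg r + ε * k) →
      T r (mode i d) * T r' (mode i (-1 - d)) = 0)
    (hT : ∀ k k' : ℕ, k + k' = m → ∀ i,
      T r (mode i (deg r + ε * k)) = B k (idx r) i ∧
      T r' (mode i (-1 - (deg r + ε * k))) = B k' (idx r') i) :
    ∑ p ∈ window n N, modeParity p * (T r p * T r' (dualMode p)) =
      if m = 0 ∧ idx r' = idx r then modeParity r else 0 := by
  have hεpow : ∀ k : ℕ, ((-1 : ℂ)) ^ (ε * (k : ℤ)) = (-1) ^ k := by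
    intro k
    rcases hε with rfl | rfl
    · simp
    · rw [neg_one_mul, zpow_neg, zpow_natCast, ← inv_pow]
      norm_num
  rw [sum_window]
  have h1 : ∑ x ∈ Finset.HasAntidiagonal.antidiagonal m,
      modeParity r * ((-1 : ℂ) ^ x.1 • (B x.1 * (B x.2).transpose)) (idx r) (idx r') =
      ∑ d ∈ Finset.Ico (-(N : ℤ)) N, ∑ i, modeParity (mode i d) *
        (T r (mode i d) * T r' (dualMode (mode i d))) := by
    refine Finset.sum_of_injOn (fun x : ℕ × ℕ => deg r + ε * x.1) ?_ ?_ ?_ ?_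
    · intro x hx y hy hxy
      have hx' := Finset.HasAntidiagonal.mem_antidiagonal.1 hx
      have hy' := Finset.HasAntidiagonal.mem_antidiagonal.1 hy
      have : x.1 = y.1 := by rcases hε with rfl | rfl <;> simp at hxy <;> omega
      ext
      · exact this
      · omega
    · intro x hx
      have hx' := Finset.HasAntidiagonal.mem_antidiagonal.1 hx
      simpa using hwin x.1 (by omega)
    · intro d _ hd
      refine Finset.sum_eq_zero fun i _ => ?_
      have := hzero d i fun k hk h => hd ⟨(k, m - k), by simp [hk], h.symm⟩
      rw [dualMode, idx_mode, deg_mode, this, mul_zero]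
    · intro x hx
      have hx' := Finset.HasAntidiagonal.mem_antidiagonal.1 hx
      simp only [Matrix.smul_apply, Matrix.mul_apply, Matrix.transpose_apply, smul_eq_mul,
        Finset.mul_sum]
      refine Finset.sum_congr rfl fun i _ => ?_
      rw [dualMode, idx_mode, deg_mode, (hT x.1 x.2 hx' i).1, (hT x.1 x.2 hx' i).2, modeParity,
        modeParity, deg_mode, zpow_add₀ (by norm_num), hεpow, mul_assoc]
  rw [← h1, ← Finset.mul_sum, ← Matrix.sum_apply, hB.right]
  by_cases hm : m = 0 <;> by_cases hi : idx r' = idx r <;>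
    simp [hm, hi, Matrix.one_apply, eq_comm (a := idx r)]

theorem eq_dualMode_iff {r r' : Mode n} :
    r' = dualMode r ↔ deg r' = -1 - deg r ∧ idx r' = idx r := by
  rw [dualMode, ← mode_idx_deg r', mode_injective, and_comm]
  rfl

theorem plusEntry_of_eq (B : ℕ → Matrix (Fin n) (Fin n) ℂ) {p q : Mode n} {k : ℕ}
    (h : deg p = deg q + k) : plusEntry B p q = B k (idx p) (idx q) := by
  rw [plusEntry, if_pos (by omega), h, add_sub_cancel_left, Int.toNat_natCast]

theorem plusEntry_of_lt (B : ℕ → Matrix (Fin n) (Fin n) ℂ) {p q : Mode n}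
    (h : deg p < deg q) : plusEntry B p q = 0 := if_neg h.not_ge

theorem minusEntry_of_eq (B : ℕ → Matrix (Fin n) (Fin n) ℂ) {p q : Mode n} {k : ℕ}
    (h : deg q = deg p + k) : minusEntry B p q = B k (idx p) (idx q) := by
  rw [minusEntry, if_pos (by omega), h, add_sub_cancel_left, Int.toNat_natCast]

theorem minusEntry_of_lt (B : ℕ → Matrix (Fin n) (Fin n) ℂ) {p q : Mode n}
    (h : deg q < deg p) : minusEntry B p q = 0 := if_neg h.not_ge

theorem isFormPreserving_plusEntry {B : ℕ → Matrix (Fin n) (Fin n) ℂ}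
    (hB : IsSymplecticSeries B) : IsFormPreserving (plusEntry B) := by
  intro N r hr r' hr'
  rw [mem_window] at hr hr'
  -- A contributing `p` needs `deg p ≤ deg r` and `-1 - deg p ≤ deg r'`, so the index is `m = deg r
  -- + deg r' + 1`, and nothing contributes if it is negative. All degrees from `-1 - deg r'` to
  -- `deg r` lie in the window, so truncation loses nothing.
  by_cases hm : 0 ≤ deg r + deg r' + 1
  · obtain ⟨m, hm⟩ := Int.eq_ofNat_of_zero_le hm
    rw [sum_window_eq hB (m := m) (ε := -1) (Or.inr rfl)]
    · refine if_congr ?_ rfl rfl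
      rw [eq_dualMode_iff]
      refine and_congr ?_ Iff.rfl
      omega
    · intro k hk
      omega
    · intro d i h
      by_cases h1 : d ≤ deg r
      · by_cases h2 : -1 - d ≤ deg r'
        · exact absurd (by omega) (h (deg r - d).toNat (by omega))
        · rw [plusEntry_of_lt (p := r') B (by rw [deg_mode]; omega), mul_zero]
      · rw [plusEntry_of_lt B (by rw [deg_mode]; omega), zero_mul]
    · intro k k' hk i
      exact ⟨plusEntry_of_eq B (by rw [deg_mode]; omega),
        plusEntry_of_eq B (by rw [deg_mode]; omega)⟩
  · rw [if_neg fun h => hm (by have := (eq_dualMode_iff.1 h).1; omega)]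
    refine Finset.sum_eq_zero fun p _ => ?_
    by_cases h1 : deg p ≤ deg r
    · rw [plusEntry_of_lt (p := r') B (by rw [deg_dualMode]; omega), mul_zero, mul_zero]
    · rw [plusEntry_of_lt B (not_le.1 h1), zero_mul, mul_zero]

theorem isFormPreserving_minusEntry {B : ℕ → Matrix (Fin n) (Fin n) ℂ}
    (hB : IsSymplecticSeries B) : IsFormPreserving (minusEntry B) := by
  intro N r hr r' hr'
  rw [mem_window] at hr hr'
  by_cases hm : 0 ≤ -1 - deg r - deg r'
  · obtain ⟨m, hm⟩ := Int.eq_ofNat_of_zero_le hm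
    rw [sum_window_eq hB (m := m) (ε := 1) (Or.inl rfl)]
    · refine if_congr ?_ rfl rfl
      rw [eq_dualMode_iff]
      refine and_congr ?_ Iff.rfl
      omega
    · intro k hk
      omega
    · intro d i h
      by_cases h1 : deg r ≤ d
      · by_cases h2 : deg r' ≤ -1 - d
        · exact absurd (by omega) (h (d - deg r).toNat (by omega))
        · rw [minusEntry_of_lt (p := r') B (by rw [deg_mode]; omega), mul_zero]
      · rw [minusEntry_of_lt B (by rw [deg_mode]; omega), zero_mul]
    · intro k k' hk i
      exact ⟨minusEntry_of_eq B (by rw [deg_mode]; omega),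
        minusEntry_of_eq B (by rw [deg_mode]; omega)⟩
  · rw [if_neg fun h => hm (by have := (eq_dualMode_iff.1 h).1; omega)]
    refine Finset.sum_eq_zero fun p _ => ?_
    by_cases h1 : deg r ≤ deg p
    · rw [minusEntry_of_lt (p := r') B (by rw [deg_dualMode]; omega), mul_zero, mul_zero]
    · rw [minusEntry_of_lt B (not_le.1 h1), zero_mul, mul_zero]

theorem isStable_plusEntry {B : ℕ → Matrix (Fin n) (Fin n) ℂ} (hB : IsSymplecticSeries B) :
    IsStable (plusEntry B) :=
  isStable_of_lowerTriangular hB.det_ne_zero (fun _ _ h => if_neg h.not_ge) fun N i j => by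
    simp [plusEntry, deg_mode, idx_mode]

/-- The transpose of a series in `z⁻¹` is block lower triangular, with diagonal block `(B 0)ᵗ`. -/
theorem isStable_minusEntry {B : ℕ → Matrix (Fin n) (Fin n) ℂ} (hB : IsSymplecticSeries B) :
    IsStable (minusEntry B) :=
  IsStable.flip (T := fun p q => minusEntry B q p) <|
    isStable_of_lowerTriangular (C := (B 0).transpose)
      (by rw [Matrix.det_transpose]; exact hB.det_ne_zero)
      (fun _ _ h => if_neg h.not_ge) fun N i j => by
        simp [minusEntry, deg_mode, idx_mode]

theorem IsSymplecticOp.intertwines_bilinearOp {A : Op n} (hA : IsSymplecticOp A) :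
    Intertwines bilinearOp bilinearOpT A := by
  induction hA with
  | plus B hB => exact intertwines_bilinearOp_groupOp (isStable_plusEntry hB)
  | minus B hB => exact intertwines_bilinearOp_groupOp (isStable_minusEntry hB)
  | mul M M' _ _ hfin ih ih' => exact intertwines_bilinearOp_idOp.mul ih ih' hfin

theorem IsSymplecticOp.intertwines_symplecticOp {A : Op n} (hA : IsSymplecticOp A) :
    Intertwines symplecticOp symplecticOpT A := by
  induction hA with
  | plus B hB =>
    exact intertwines_symplecticOp_groupOp (isStable_plusEntry hB)
      (isFormPreserving_plusEntry hB)
  | minus B hB =>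
    exact intertwines_symplecticOp_groupOp (isStable_minusEntry hB)
      (isFormPreserving_minusEntry hB)
  | mul M M' _ _ hfin ih ih' => exact intertwines_symplecticOp_idOp.mul ih ih' hfin

end VanDeLeur

end

/-! ### The operators `α_i` and their exponentials on the tensor square. -/

noncomputable section

namespace VanDeLeur

variable {n : ℕ}

open Maya TensorProduct

/-- Contraction kills low `d`. For `k ≠ 0` the two modes differ, so the operators anticommute and
exterior multiplication, applied first, kills high `d`. -/
theorem finite_support_wedge_contract (i : Fin n) {k : ℤ} (hk : k ≠ 0) (f : Fock n) :
    (Function.support fun d : ℤ => wedge (mode i (d + k)) (contract (mode i d) f)).Finite := by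
  obtain ⟨b, hb⟩ := exists_wedge_eq_zero f
  obtain ⟨a, ha⟩ := exists_contract_eq_zero f
  refine (Set.finite_Icc a (b - k)).subset fun d hd => ⟨?_, ?_⟩ <;> by_contra! h <;> apply hd
  · simp [ha (mode i d) h]
  · have hne : mode i d ≠ mode i (d + k) := fun h => hk (by have := (mode_injective.1 h).2; omega)
    change wedge _ _ = 0
    rw [← neg_neg (wedge _ _), ← contract_wedge hne, hb _ (by rw [deg_mode]; omega), map_zero,
      neg_zero]

theorem leibniz_single_apply (i : Fin n) {k : ℤ} (hk : k ≠ 0) (f : Fock n) :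
    leibniz (Matrix.single i i 1) k f =
      ∑ᶠ d : ℤ, wedge (mode i (d + k)) (contract (mode i d) f) := by
  induction f using Finsupp.induction_linear with
  | zero => simp
  | add f g hf hg =>
    simp only [map_add, hf, hg]
    exact (finsum_add_distrib (finite_support_wedge_contract i hk f)
      (finite_support_wedge_contract i hk g)).symm
  | single v c =>
    rw [← Finsupp.smul_single_one, map_smul]
    simp only [map_smul]
    rw [← smul_finsum' c (finite_support_wedge_contract i hk _), leibniz,
      Finsupp.linearCombination_single, one_smul]
    congr 1
    refine finsum_congr fun d => ?_
    rw [Finset.sum_eq_single i, Finset.sum_eq_single i]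
    · simp
    · intro j _ hj
      simp [hj.symm]
    · simp
    · intro j _ hj
      simp [hj.symm]
    · simp

/-- The basis vector `e_i z^(d+k)` for `p = e_i z^d`. -/
def shift (k : ℤ) : Mode n ≃ Mode n where
  toFun p := mode (idx p) (deg p + k)
  invFun p := mode (idx p) (deg p - k)
  left_inv p := by simp [deg_mode, idx_mode, mode_idx_deg]
  right_inv p := by simp [deg_mode, idx_mode, mode_idx_deg]

theorem deg_shift (k : ℤ) (p : Mode n) : deg (shift k p) = deg p + k := rfl

theorem deg_shift_symm (k : ℤ) (p : Mode n) : deg ((shift k).symm p) = deg p - k := rfl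

theorem idx_shift_symm (k : ℤ) (p : Mode n) : idx ((shift k).symm p) = idx p := rfl

/-- The operator is a derivation: its commutator with `q ∧` is exterior multiplication by the image
of `q`, produced by the single summand that contracts with `q`. For `∂_q` in `leibniz_contract` the
commutator is minus contraction with the preimage of `q`. -/
theorem leibniz_wedge (i : Fin n) {k : ℤ} (hk : k ≠ 0) (q : Mode n) (f : Fock n) :
    leibniz (Matrix.single i i 1) k (wedge q f) =
      wedge q (leibniz (Matrix.single i i 1) k f) +
        if idx q = i then wedge (shift k q) f else 0 := by
  have hterm : ∀ d : ℤ, wedge (mode i (d + k)) (contract (mode i d) (wedge q f)) =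
      wedge q (wedge (mode i (d + k)) (contract (mode i d) f)) +
        if mode i d = q then wedge (shift k q) f else 0 := by
    intro d
    by_cases h : mode i d = q
    · subst h
      rw [if_pos rfl, contract_wedge_self, map_sub, wedge_wedge _ (mode i d), sub_neg_eq_add,
        add_comm]
      rfl
    · rw [if_neg h, contract_wedge h, map_neg, wedge_wedge _ q, neg_neg, add_zero]
  rw [leibniz_single_apply i hk, leibniz_single_apply i hk,
    map_finsum _ (finite_support_wedge_contract i hk f), finsum_congr hterm, finsum_add_distrib]
  · congr 1
    by_cases hi : idx q = i
    · rw [finsum_eq_single _ (deg q), if_pos hi, if_pos]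
      · rw [← hi, mode_idx_deg]
      · intro d hd
        refine if_neg ?_
        rintro rfl
        exact hd rfl
    · rw [if_neg hi, finsum_eq_zero_of_forall_eq_zero]
      intro d
      refine if_neg ?_
      rintro rfl
      exact hi rfl
  · exact (finite_support_wedge_contract i hk f).subset
      (Function.support_comp_subset (map_zero _) _)
  · refine (Set.finite_singleton (deg q)).subset fun d hd => ?_
    by_contra h
    refine hd (if_neg ?_)
    rintro rfl
    exact h rfl

theorem leibniz_contract (i : Fin n) {k : ℤ} (hk : k ≠ 0) (q : Mode n) (f : Fock n) :
    leibniz (Matrix.single i i 1) k (contract q f) =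
      contract q (leibniz (Matrix.single i i 1) k f) +
        if idx q = i then -contract ((shift k).symm q) f else 0 := by
  have hterm : ∀ d : ℤ, wedge (mode i (d + k)) (contract (mode i d) (contract q f)) =
      contract q (wedge (mode i (d + k)) (contract (mode i d) f)) +
        if mode i (d + k) = q then -contract ((shift k).symm q) f else 0 := by
    intro d
    rw [contract_contract _ q, map_neg]
    by_cases h : mode i (d + k) = q
    · subst h
      rw [if_pos rfl, contract_wedge_self]
      have : (shift k).symm (mode i (d + k)) = mode i d := by
        rw [Equiv.symm_apply_eq]
        rfl
      rw [this]
      abel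
    · rw [if_neg h, contract_wedge (Ne.symm h), add_zero]
  have hiff : ∀ d : ℤ, mode i (d + k) = q → d = deg q - k := by
    rintro d rfl
    rw [deg_mode, add_sub_cancel_right]
  rw [leibniz_single_apply i hk, leibniz_single_apply i hk,
    map_finsum _ (finite_support_wedge_contract i hk f), finsum_congr hterm, finsum_add_distrib]
  · congr 1
    by_cases hi : idx q = i
    · rw [finsum_eq_single _ (deg q - k), if_pos hi, if_pos]
      · rw [sub_add_cancel, ← hi, mode_idx_deg]
      · exact fun d hd => if_neg fun h => hd (hiff d h)
    · rw [if_neg hi, finsum_eq_zero_of_forall_eq_zero]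
      intro d
      refine if_neg ?_
      rintro rfl
      exact hi rfl
  · exact (finite_support_wedge_contract i hk f).subset
      (Function.support_comp_subset (map_zero _) _)
  · refine (Set.finite_singleton (deg q - k)).subset fun d hd => ?_
    by_contra h
    exact hd (if_neg fun h' => h (hiff d h'))

/-- The Leibniz extension of an operator to the tensor square. -/
def derivation2 (D : Module.End ℂ (Fock n)) : Module.End ℂ (Fock n ⊗[ℂ] Fock n) :=
  TensorProduct.map D 1 + TensorProduct.map 1 D

theorem derivation2_tmul (D : Module.End ℂ (Fock n)) (f g : Fock n) :
    derivation2 D (f ⊗ₜ g) = D f ⊗ₜ g + f ⊗ₜ D g := rfl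

/-- Here `X'` and `Y'` are the commutators of `D` with `X` and `Y`; commutation means that their
total contribution `h0` cancels. -/
theorem commute_derivation2_pairOp {X Y X' Y' : Mode n → Module.End ℂ (Fock n)}
    (h : IsLocallyFinite X Y) {D : Module.End ℂ (Fock n)}
    (hX : ∀ p f, D (X p f) = X p (D f) + X' p f) (hY : ∀ p f, D (Y p f) = Y p (D f) + Y' p f)
    (h0 : ∀ f g, ∑ᶠ p, (X' p f ⊗ₜ[ℂ] Y p g + X p f ⊗ₜ[ℂ] Y' p g) = 0) :
    Commute (derivation2 D) (pairOp X Y h) := by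
  refine TensorProduct.ext' fun f g => ?_
  rw [Module.End.mul_apply, Module.End.mul_apply, derivation2_tmul, map_add, pairOp_tmul,
    pairOp_tmul, pairOp_tmul, map_finsum _ (h f g), ← finsum_add_distrib (h _ _) (h _ _)]
  have hterm : ∀ p, derivation2 D (X p f ⊗ₜ[ℂ] Y p g) =
      (X p (D f) ⊗ₜ[ℂ] Y p g + X p f ⊗ₜ[ℂ] Y p (D g)) +
        (X' p f ⊗ₜ[ℂ] Y p g + X p f ⊗ₜ[ℂ] Y' p g) := by
    intro p
    rw [derivation2_tmul, hX, hY, TensorProduct.add_tmul, TensorProduct.tmul_add]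
    abel
  have hfin := ((h (D f) g).union (h f (D g))).subset (Function.support_add _ _)
  rw [finsum_congr hterm, finsum_add_distrib hfin, h0, add_zero]
  -- Splitting the `finsum` requires finite support of the remainder, which follows by subtraction
  -- from the finite supports of the other two families.
  have h' : (Function.support fun p => derivation2 D (X p f ⊗ₜ[ℂ] Y p g)).Finite :=
    (h f g).subset (Function.support_comp_subset (map_zero _) _)
  refine (h'.union hfin).subset ?_
  intro p hp
  by_contra hn
  simp only [Set.mem_union, not_or, Function.notMem_support] at hn
  have := hterm p
  rw [hn.1, hn.2, zero_add] at this
  exact hp this.symm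

theorem finsum_sub_comp_equiv {ι M : Type*} [AddCommGroup M] (e : ι ≃ ι) {u : ι → M}
    (hu : (Function.support u).Finite) : ∑ᶠ p, (u p - u (e p)) = 0 := by
  rw [finsum_sub_distrib hu, finsum_comp_equiv, sub_self]
  exact hu.preimage e.injective.injOn

theorem alpha_def (i : Fin n) : alpha i = leibniz (Matrix.single i i 1) 1 := rfl

/-- With `u p = shift p ∧ ⊗ ∂_p`, for modes `p` of index `i`, the commutator is the sum of `u p - u
(shift⁻¹ p)`, which vanishes by reindexing. -/
theorem commute_alpha_bilinearOp (i : Fin n) : Commute (derivation2 (alpha i)) bilinearOp := by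
  refine commute_derivation2_pairOp
    (X' := fun p => if idx p = i then wedge (shift 1 p) else 0)
    (Y' := fun p => if idx p = i then -contract ((shift 1).symm p) else 0) _
    (fun p f => ?_) (fun p f => ?_) (fun f g => ?_)
  · rw [alpha_def, leibniz_wedge i one_ne_zero]
    split_ifs <;> rfl
  · rw [alpha_def, leibniz_contract i one_ne_zero]
    split_ifs <;> rfl
  · have hu : (Function.support fun p : Mode n => if idx p = i then
        wedge (shift 1 p) f ⊗ₜ[ℂ] contract p g else 0).Finite := by
      obtain ⟨b, hb⟩ := exists_wedge_eq_zero f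
      obtain ⟨a, ha⟩ := exists_contract_eq_zero g
      refine (finite_deg_mem_Icc a b).subset fun p hp => ⟨?_, ?_⟩ <;> by_contra! h <;> apply hp
      · simp [ha p h]
      · simp [hb (shift 1 p) (by rw [deg_shift]; omega)]
    refine Eq.trans (finsum_congr fun p => ?_)
      (finsum_sub_comp_equiv (M := Fock n ⊗[ℂ] Fock n) (shift 1).symm hu)
    rw [idx_shift_symm, Equiv.apply_symm_apply]
    split_ifs
    · rw [LinearMap.neg_apply, TensorProduct.tmul_neg, sub_eq_add_neg]
    · simp

theorem commute_alpha_symplecticOp (i : Fin n) :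
    Commute (derivation2 (alpha i)) symplecticOp := by
  refine commute_derivation2_pairOp
    (X' := fun p => if idx p = i then wedge (shift 1 p) else 0)
    (Y' := fun p => if idx p = i then modeParity p • wedge (shift 1 (dualMode p)) else 0) _
    (fun p f => ?_) (fun p f => ?_) (fun f g => ?_)
  · rw [alpha_def, leibniz_wedge i one_ne_zero]
    split_ifs <;> rfl
  · rw [alpha_def, LinearMap.smul_apply, LinearMap.smul_apply, map_smul,
      leibniz_wedge i one_ne_zero, smul_add, idx_dualMode]
    split_ifs
    · rfl
    · rw [smul_zero]
      rfl
  · have hu : (Function.support fun p : Mode n => if idx p = i then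
        wedge (shift 1 p) f ⊗ₜ[ℂ] (modeParity p • wedge (dualMode p)) g else 0).Finite := by
      obtain ⟨b, hb⟩ := exists_wedge_eq_zero f
      obtain ⟨b', hb'⟩ := exists_wedge_eq_zero g
      refine (finite_deg_mem_Icc (-1 - b') b).subset fun p hp => ⟨?_, ?_⟩ <;> by_contra! h <;>
        apply hp
      · simp [hb' (dualMode p) (by rw [deg_dualMode]; omega)]
      · simp [hb (shift 1 p) (by rw [deg_shift]; omega)]
    refine Eq.trans (finsum_congr fun p => ?_)
      (finsum_sub_comp_equiv (M := Fock n ⊗[ℂ] Fock n) (shift 1).symm hu)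
    rw [idx_shift_symm, Equiv.apply_symm_apply]
    have h1 : dualMode ((shift 1).symm p) = shift 1 (dualMode p) := by
      change mode _ _ = mode _ _
      rw [deg_shift_symm, deg_dualMode]
      congr 1
      ring
    -- Dualization exchanges the two shifts, so both commutator terms have the same shape. The
    -- alternating sign `(-1)^d` makes them cancel after reindexing.
    have h2 : modeParity ((shift 1).symm p) = -modeParity p := by
      rw [modeParity, deg_shift_symm, zpow_sub₀ (by norm_num), modeParity, zpow_one, div_neg,
        div_one]
    rw [h1, h2]
    split_ifs
    · simp only [LinearMap.smul_apply, neg_smul, TensorProduct.tmul_neg]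
      exact (sub_neg_eq_add (α := Fock n ⊗[ℂ] Fock n) _ _).symm
    · simp

/-- Coefficientwise form of `∏ F_i(u_i) · ∏ G_i(u_i) = ∏ F_i(u_i) G_i(u_i)`; commutation is needed
to interleave the two ordered products. -/
theorem sum_antidiagonal_prod_ofFn {R : Type*} [Semiring R] {n : ℕ} (F G : Fin n → ℕ → R)
    (hFG : ∀ i j a b, Commute (F i a) (G j b)) (m : Fin n →₀ ℕ) :
    ∑ x ∈ Finset.HasAntidiagonal.antidiagonal m,
        (List.ofFn fun i => F i (x.1 i)).prod * (List.ofFn fun i => G i (x.2 i)).prod =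
      (List.ofFn fun i =>
        ∑ y ∈ Finset.HasAntidiagonal.antidiagonal (m i), F i y.1 * G i y.2).prod := by
  induction n with
  | zero =>
    have : m = 0 := Subsingleton.elim _ _
    subst this
    simp
  | succ n ih =>
    have ih' := ih (fun i => F i.succ) (fun i => G i.succ) (fun i j => hFG _ _) m.tail
    simp only [Finsupp.tail_apply] at ih'
    rw [List.ofFn_succ, List.prod_cons, ← ih', Finset.sum_mul_sum, ← Finset.sum_product']
    refine Finset.sum_nbij' (fun x => ((x.1 0, x.2 0), (x.1.tail, x.2.tail)))
      (fun y => (y.2.1.cons y.1.1, y.2.2.cons y.1.2)) ?_ ?_ ?_ ?_ ?_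
    · intro x hx
      rw [Finset.HasAntidiagonal.mem_antidiagonal] at hx
      simp only [Finset.mem_product, Finset.HasAntidiagonal.mem_antidiagonal, ← hx]
      refine ⟨rfl, ?_⟩
      ext
      rfl
    · rintro ⟨y, z⟩ hy
      simp only [Finset.mem_product, Finset.HasAntidiagonal.mem_antidiagonal] at hy
      rw [Finset.HasAntidiagonal.mem_antidiagonal]
      ext j
      refine Fin.cases ?_ (fun j => ?_) j
      · simpa using hy.1
      · simpa [Finsupp.tail_apply] using DFunLike.congr_fun hy.2 j
    · intro x _
      simp [Finsupp.cons_tail]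
    · intro y _
      simp [Finsupp.tail_cons]
    · intro x _
      have hc : Commute (List.ofFn fun i : Fin n => F i.succ (x.1 i.succ)).prod (G 0 (x.2 0)) := by
        refine Commute.list_prod_left _ _ fun y hy => ?_
        obtain ⟨i, rfl⟩ := (List.mem_ofFn' _ _).1 hy
        exact hFG _ _ _ _
      simp only [List.ofFn_succ, List.prod_cons, Finsupp.tail_apply]
      rw [mul_assoc, ← mul_assoc _ (G 0 _), hc.eq]
      simp only [mul_assoc]

theorem sum_antidiagonal_divided_pow {R : Type*} [Semiring R] [Algebra ℂ R] {x y : R}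
    (h : Commute x y) (k : ℕ) :
    ∑ z ∈ Finset.HasAntidiagonal.antidiagonal k,
        ((z.1.factorial : ℂ)⁻¹ • x ^ z.1) * ((z.2.factorial : ℂ)⁻¹ • y ^ z.2) =
      (k.factorial : ℂ)⁻¹ • (x + y) ^ k := by
  rw [h.add_pow', Finset.smul_sum]
  refine Finset.sum_congr rfl fun z hz => ?_
  rw [Finset.HasAntidiagonal.mem_antidiagonal] at hz
  subst hz
  rw [smul_mul_smul_comm, ← Nat.cast_smul_eq_nsmul ℂ, smul_smul]
  congr 1
  rw [Nat.cast_add_choose]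
  have h1 : ((z.1 + z.2).factorial : ℂ) ≠ 0 := Nat.cast_ne_zero.2 (Nat.factorial_ne_zero _)
  have h2 : (z.1.factorial : ℂ) ≠ 0 := Nat.cast_ne_zero.2 (Nat.factorial_ne_zero _)
  have h3 : (z.2.factorial : ℂ) ≠ 0 := Nat.cast_ne_zero.2 (Nat.factorial_ne_zero _)
  field_simp

/-- The coefficient at `u^m` of the action of `exp (∑ i, α_i u_i)` on the tensor square. -/
def expAlpha2 (m : Fin n →₀ ℕ) : Module.End ℂ (Fock n ⊗[ℂ] Fock n) :=
  ∑ x ∈ Finset.HasAntidiagonal.antidiagonal m, TensorProduct.map (expAlpha x.1) (expAlpha x.2)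

/-- The exponential is group-like: `α ⊗ 1` and `1 ⊗ α` commute, so `exp α ⊗ exp α` is the
exponential of `α ⊗ 1 + 1 ⊗ α`. Commutation with `derivation2 (alpha i)` therefore passes to the
exponential. -/
theorem expAlpha2_eq (m : Fin n →₀ ℕ) :
    expAlpha2 m =
      (List.ofFn fun i : Fin n => ((m i).factorial : ℂ)⁻¹ • derivation2 (alpha i) ^ m i).prod := by
  let l : Module.End ℂ (Fock n) →ₐ[ℂ] Module.End ℂ (Fock n ⊗[ℂ] Fock n) :=
    Module.End.rTensorAlgHom ℂ (Fock n) (Fock n)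
  let r : Module.End ℂ (Fock n) →ₐ[ℂ] Module.End ℂ (Fock n ⊗[ℂ] Fock n) :=
    Module.End.lTensorAlgHom ℂ (Fock n) (Fock n)
  have hlr : ∀ X Y, TensorProduct.map X Y = l X * r Y := fun X Y =>
    TensorProduct.ext' fun f g => rfl
  have hcomm : ∀ X Y, Commute (l X) (r Y) := fun X Y =>
    TensorProduct.ext' fun f g => rfl
  have hd : ∀ i : Fin n, derivation2 (alpha i) = l (alpha i) + r (alpha i) := fun i => rfl
  have hpow : ∀ (i : Fin n) (k : ℕ), _ := fun i k =>
    sum_antidiagonal_divided_pow (R := Module.End ℂ (Fock n ⊗[ℂ] Fock n))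
      (hcomm (alpha i) (alpha i)) k
  simp only [hd, ← hpow]
  rw [← sum_antidiagonal_prod_ofFn
    (fun i k => (k.factorial : ℂ)⁻¹ • l (alpha i) ^ k)
    (fun i k => (k.factorial : ℂ)⁻¹ • r (alpha i) ^ k)
    (fun i j a b => (((hcomm _ _).pow_pow a b).smul_left _).smul_right _), expAlpha2]
  refine Finset.sum_congr rfl fun x _ => ?_
  rw [hlr, expAlpha, expAlpha, map_list_prod, map_list_prod, List.map_ofFn, List.map_ofFn]
  simp only [Function.comp_def, map_smul, map_pow]

theorem commute_expAlpha2 {Ω : Module.End ℂ (Fock n ⊗[ℂ] Fock n)}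
    (h : ∀ i, Commute (derivation2 (alpha i)) Ω) (m : Fin n →₀ ℕ) :
    Commute (expAlpha2 m) Ω := by
  rw [expAlpha2_eq]
  refine Commute.list_prod_left _ _ fun y hy => ?_
  obtain ⟨i, rfl⟩ := (List.mem_ofFn' _ _).1 hy
  exact ((h i).pow_left _).smul_left _

theorem isTranspose_alpha (i : Fin n) :
    IsTranspose (alpha i) (leibniz (Matrix.single i i 1) (-1)) := by
  intro a b
  rw [bil_idOp_comm, alpha_def, leibniz_single_apply i (by norm_num),
    leibniz_single_apply i one_ne_zero,
    map_finsum _ (finite_support_wedge_contract i (by norm_num) a),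
    map_finsum _ (finite_support_wedge_contract i one_ne_zero b),
    ← finsum_comp_equiv (Equiv.addRight (1 : ℤ))]
  refine finsum_congr fun d => ?_
  rw [Equiv.coe_addRight, add_neg_cancel_right, bil_idOp_comm, (isTranspose_wedge _).symm,
    isTranspose_wedge]

theorem exists_isTranspose_pow {X : Module.End ℂ (Fock n)} (h : ∃ Xt, IsTranspose X Xt) (k : ℕ) :
    ∃ Xt, IsTranspose (X ^ k) Xt := by
  induction k with
  | zero => exact ⟨1, isTranspose_one⟩
  | succ k ih =>
    obtain ⟨Xt, hX⟩ := h
    obtain ⟨Yt, hY⟩ := ih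
    exact ⟨_, hY.mul hX⟩

theorem exists_isTranspose_list_prod (l : List (Module.End ℂ (Fock n)))
    (h : ∀ X ∈ l, ∃ Xt, IsTranspose X Xt) : ∃ Xt, IsTranspose l.prod Xt := by
  induction l with
  | nil => exact ⟨1, isTranspose_one⟩
  | cons X l ih =>
    obtain ⟨Xt, hX⟩ := h X List.mem_cons_self
    obtain ⟨Yt, hY⟩ := ih fun Z hZ => h Z (List.mem_cons_of_mem _ hZ)
    exact ⟨_, hX.mul hY⟩

theorem exists_isTranspose_expAlpha (m : Fin n →₀ ℕ) : ∃ Xt, IsTranspose (expAlpha m) Xt := by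
  refine exists_isTranspose_list_prod _ fun X hX => ?_
  obtain ⟨i, rfl⟩ := (List.mem_ofFn' _ _).1 hX
  obtain ⟨Xt, h⟩ := exists_isTranspose_pow ⟨_, isTranspose_alpha i⟩ (m i)
  exact ⟨_, h.smul _⟩

/-- The transpose of `expAlpha m`. -/
def expAlphaT (m : Fin n →₀ ℕ) : Module.End ℂ (Fock n) :=
  (exists_isTranspose_expAlpha m).choose

theorem isTranspose_expAlpha (m : Fin n →₀ ℕ) : IsTranspose (expAlpha m) (expAlphaT m) :=
  (exists_isTranspose_expAlpha m).choose_spec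

/-- The transpose of `expAlpha2 m`. -/
def expAlphaT2 (m : Fin n →₀ ℕ) : Module.End ℂ (Fock n ⊗[ℂ] Fock n) :=
  ∑ x ∈ Finset.HasAntidiagonal.antidiagonal m, TensorProduct.map (expAlphaT x.1) (expAlphaT x.2)

theorem bil2_expAlphaT2 (m : Fin n →₀ ℕ) (s t : Fock n ⊗[ℂ] Fock n) :
    bil2 idOp (expAlphaT2 m s) t = bil2 idOp s (expAlpha2 m t) := by
  induction s using TensorProduct.induction_on with
  | zero => simp
  | add x y hx hy => simp [hx, hy]
  | tmul a a' =>
    induction t using TensorProduct.induction_on with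
    | zero => simp
    | add x y hx hy => simp [hx, hy]
    | tmul b b' =>
      simp only [expAlphaT2, expAlpha2, LinearMap.sum_apply, map_sum, TensorProduct.map_tmul,
        bil2_tmul]
      refine Finset.sum_congr rfl fun x _ => ?_
      rw [isTranspose_expAlpha, isTranspose_expAlpha]

theorem expAlphaT2_comm {Ω Ωt : Module.End ℂ (Fock n ⊗[ℂ] Fock n)} (hid : Intertwines Ω Ωt idOp)
    (h : ∀ i, Commute (derivation2 (alpha i)) Ω) (m : Fin n →₀ ℕ) (s : Fock n ⊗[ℂ] Fock n) :
    expAlphaT2 m (Ωt s) = Ωt (expAlphaT2 m s) := by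
  refine eq_of_bil2_idOp_left fun t => ?_
  have hc : expAlpha2 m (Ω t) = Ω (expAlpha2 m t) :=
    LinearMap.congr_fun (commute_expAlpha2 h m).eq t
  rw [bil2_expAlphaT2, hid, ← hc, ← bil2_expAlphaT2, hid]

/-- The exponential is moved to the left vector by transposition. The left vector remains a finite
combination, even if the columns of `A` are infinite. -/
theorem matrixElement_apply (A : Op n) (a b : Fock n) (m : Fin n →₀ ℕ) :
    MvPowerSeries.coeff m (matrixElement A a b) = bil A (expAlphaT m a) b := by
  have hx : ∀ x, pairing a (expAlpha m (Finsupp.single x 1)) = expAlphaT m a x := fun x => by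
    rw [pairing_eq_bil, ← isTranspose_expAlpha, bil_idOp_comm, bil_idOp_single_left]
  have hb : ∀ x, (b.sum fun y c => A x y * c) = Finsupp.linearCombination ℂ (A x) b := fun x => by
    rw [Finsupp.linearCombination_apply]
    simp only [smul_eq_mul, mul_comm]
  change ∑ᶠ x, _ = _
  simp only [hx, hb]
  rw [bil, Finsupp.linearCombination_apply, Finsupp.sum, LinearMap.sum_apply,
    finsum_eq_sum_of_support_subset]
  · rfl
  · intro x hx
    simp only [Finset.mem_coe, Finsupp.mem_support_iff]
    exact left_ne_zero_of_mul hx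

/-- The matrix elements of `exp (∑ i, α_i u_i) A` as a bilinear map. -/
def element (A : Op n) : Fock n →ₗ[ℂ] Fock n →ₗ[ℂ] MvPowerSeries (Fin n) ℂ :=
  LinearMap.mk₂ ℂ (matrixElement A)
    (fun _ _ _ => by ext m; simp [matrixElement_apply])
    (fun _ _ _ => by ext m; simp [matrixElement_apply])
    (fun _ _ _ => by ext m; simp [matrixElement_apply])
    (fun _ _ _ => by ext m; simp [matrixElement_apply])

theorem element_apply (A : Op n) (a b : Fock n) : element A a b = matrixElement A a b := rfl

/-- The matrix elements of the tensor square of `exp (∑ i, α_i u_i) A` as a bilinear map. -/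
def element2 (A : Op n) (s t : Fock n ⊗[ℂ] Fock n) : MvPowerSeries (Fin n) ℂ :=
  fun m => bil2 A (expAlphaT2 m s) t

theorem coeff_element2 (A : Op n) (s t : Fock n ⊗[ℂ] Fock n) (m : Fin n →₀ ℕ) :
    MvPowerSeries.coeff m (element2 A s t) = bil2 A (expAlphaT2 m s) t := rfl

theorem element2_tmul (A : Op n) (a a' b b' : Fock n) :
    element2 A (a ⊗ₜ a') (b ⊗ₜ b') = element A a b * element A a' b' := by
  ext m
  rw [coeff_element2, MvPowerSeries.coeff_mul, expAlphaT2, LinearMap.sum_apply, map_sum,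
    LinearMap.sum_apply]
  refine Finset.sum_congr rfl fun x _ => ?_
  rw [TensorProduct.map_tmul, bil2_tmul, element_apply, element_apply, matrixElement_apply,
    matrixElement_apply]

theorem element2_add_right (A : Op n) (s t t' : Fock n ⊗[ℂ] Fock n) :
    element2 A s (t + t') = element2 A s t + element2 A s t' := by
  ext m
  simp [coeff_element2]

/-- The first two hypotheses move `Ωt` past the transposed exponential, the third past `A`. -/
theorem element2_intertwines {A : Op n} {Ω Ωt : Module.End ℂ (Fock n ⊗[ℂ] Fock n)}
    (hid : Intertwines Ω Ωt idOp) (h : ∀ i, Commute (derivation2 (alpha i)) Ω)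
    (hA : Intertwines Ω Ωt A) (s t : Fock n ⊗[ℂ] Fock n) :
    element2 A (Ωt s) t = element2 A s (Ω t) := by
  ext m
  rw [coeff_element2, coeff_element2, expAlphaT2_comm hid h, hA]

end VanDeLeur

end

/-! ### Evaluation near the vacuum: the quadratic relations for matrix elements. -/

noncomputable section

namespace VanDeLeur

variable {n : ℕ}

open Maya TensorProduct

theorem wedge_contract_vac_self {q : Mode n} (hq : 0 ≤ deg q) :
    wedge q (contract q vac) = vac := by
  have := contract_wedge_self q vac
  rw [wedge_vac hq, map_zero] at this
  exact (sub_eq_zero.1 this.symm).symm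

theorem contract_wedge_vac_self {p : Mode n} (hp : deg p < 0) :
    contract p (wedge p vac) = vac := by
  rw [contract_wedge_self, contract_vac hp, map_zero, sub_zero]

theorem wedge_contract_vac_of_ne {p q : Mode n} (hpq : p ≠ q) (hp : 0 ≤ deg p) :
    wedge p (contract q vac) = 0 := by
  rw [← neg_neg (wedge _ _), ← contract_wedge hpq.symm, wedge_vac hp, map_zero, neg_zero]

theorem contract_wedge_vac_of_ne {p q : Mode n} (hpq : p ≠ q) (hp : deg p < 0) :
    contract p (wedge q vac) = 0 := by
  rw [contract_wedge hpq, contract_vac hp, map_zero, neg_zero]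

/-- Only two modes survive: a mode of nonnegative degree can be wedged into `∂_q|0⟩` only if it is
`q`, and one of negative degree can be contracted out of `p ∧ |0⟩` only if it is `p`. -/
theorem bilinearOp_contract_wedge_vac {p q : Mode n} (hp : deg p < 0) (hq : 0 ≤ deg q) :
    bilinearOp (contract q vac ⊗ₜ wedge p vac) =
      wedge p (contract q vac) ⊗ₜ vac + vac ⊗ₜ (-wedge p (contract q vac)) := by
  have hpq : p ≠ q := by
    rintro rfl
    omega
  rw [bilinearOp, pairOp_tmul, finsum_eq_sum_of_support_subset (s := {p, q}),
    Finset.sum_pair hpq, wedge_contract_vac_self hq, contract_wedge_vac_self hp,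
    contract_wedge hpq.symm]
  intro k hk
  by_contra h
  simp only [Finset.coe_insert, Finset.coe_singleton, Set.mem_insert_iff, Set.mem_singleton_iff,
    not_or] at h
  apply hk
  rcases lt_or_ge (deg k) 0 with hk0 | hk0
  · simp [contract_wedge_vac_of_ne h.1 hk0]
  · simp [wedge_contract_vac_of_ne h.2 hk0]

theorem bilinearOpT_wedge_contract_vac {p q : Mode n} (hp : deg p < 0) :
    bilinearOpT (wedge p (contract q vac) ⊗ₜ vac) = contract q vac ⊗ₜ wedge p vac := by
  rw [bilinearOpT, pairOp_tmul, finsum_eq_single _ p]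
  · rw [contract_wedge_self, contract_contract, contract_vac hp]
    simp
  · intro k hk
    rcases lt_or_ge (deg k) 0 with hk0 | hk0
    · rw [contract_wedge hk, contract_contract, contract_vac hk0]
      simp
    · simp [wedge_vac hk0]

/-- A mode `k` of negative degree has a dual of nonnegative degree, which kills the second vacuum;
among the others only `k = q` fits into `∂_q|0⟩`. -/
theorem symplecticOp_contract_vac {q : Mode n} (hq : 0 ≤ deg q) :
    symplecticOp (contract q vac ⊗ₜ vac) = vac ⊗ₜ (modeParity q • wedge (dualMode q) vac) := by
  rw [symplecticOp, pairOp_tmul, finsum_eq_single _ q, wedge_contract_vac_self hq]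
  · rfl
  · intro k hk
    rcases lt_or_ge (deg k) 0 with hk0 | hk0
    · rw [LinearMap.smul_apply, wedge_vac (p := dualMode k) (by rw [deg_dualMode]; omega)]
      simp
    · simp [wedge_contract_vac_of_ne hk hk0]

theorem symplecticOpT_wedge_vac {q : Mode n} (hq : 0 ≤ deg q) :
    symplecticOpT (vac ⊗ₜ wedge (dualMode q) vac) = contract q vac ⊗ₜ (modeParity q • vac) := by
  have hq' : deg (dualMode q) < 0 := by
    rw [deg_dualMode]
    omega
  rw [symplecticOpT, pairOp_tmul, finsum_eq_single _ q, LinearMap.smul_apply,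
    contract_wedge_vac_self hq']
  intro k hk
  have hk' : dualMode k ≠ dualMode q := fun h => hk <| by
    rw [← dualMode_dualMode k, h, dualMode_dualMode]
  rcases lt_or_ge (deg k) 0 with hk0 | hk0
  · simp [contract_vac hk0]
  · rw [LinearMap.smul_apply, contract_wedge_vac_of_ne hk' (by rw [deg_dualMode]; omega)]
    simp

/-- A Plücker relation between the matrix elements of `exp (∑ i, α_i u_i) A`. -/
theorem IsSymplecticOp.element_plucker {A : Op n} (hA : IsSymplecticOp A) {p q p' q' : Mode n}
    (hp : deg p < 0) (hq : 0 ≤ deg q) (hp' : deg p' < 0) :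
    element A (wedge p' (contract q' vac)) (wedge p (contract q vac)) * element A vac vac -
        element A (wedge p' (contract q' vac)) vac * element A vac (wedge p (contract q vac)) =
      element A (contract q' vac) (contract q vac) * element A (wedge p' vac) (wedge p vac) := by
  have h := element2_intertwines intertwines_bilinearOp_idOp commute_alpha_bilinearOp
    hA.intertwines_bilinearOp (wedge p' (contract q' vac) ⊗ₜ vac) (contract q vac ⊗ₜ wedge p vac)
  rw [bilinearOpT_wedge_contract_vac hp', bilinearOp_contract_wedge_vac hp hq,
    element2_add_right, element2_tmul, element2_tmul, element2_tmul, map_neg] at h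
  rw [h]
  ring

/-- Here the symplectic condition turns matrix elements between vectors with one factor removed into
entries of the wave functions. Both sides of the quadratic relation contain `⟨0|𝒜|0⟩`, which cancels
in the domain of power series. -/
theorem IsSymplecticOp.element_contract_vac {A : Op n} (hA : IsSymplecticOp A)
    (hτ : matrixElement A vac vac ≠ 0) {q q' : Mode n} (hq : 0 ≤ deg q) (hq' : 0 ≤ deg q') :
    modeParity q' • element A (contract q' vac) (contract q vac) =
      modeParity q • element A (wedge (dualMode q') vac) (wedge (dualMode q) vac) := by
  have h := element2_intertwines intertwines_symplecticOp_idOp commute_alpha_symplecticOp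
    hA.intertwines_symplecticOp (vac ⊗ₜ wedge (dualMode q') vac) (contract q vac ⊗ₜ vac)
  rw [symplecticOpT_wedge_vac hq', symplecticOp_contract_vac hq, element2_tmul, element2_tmul,
    map_smul, map_smul, LinearMap.smul_apply] at h
  refine mul_left_cancel₀ (a := element A vac vac) hτ ?_
  rw [← h, mul_smul_comm, mul_smul_comm, mul_comm]

theorem HasParity.diag_eq_zero {m : Matrix (Fin n) (Fin n) ℂ} (h : HasParity 0 m) (i : Fin n) :
    m i i = 0 := by
  have := congrFun (congrFun (h.2 Even.zero) i) i
  simp only [Matrix.transpose_apply, Matrix.neg_apply] at this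
  exact self_eq_neg.1 this

theorem leibniz_vac (m : Matrix (Fin n) (Fin n) ℂ) (k : ℤ) :
    leibniz m k vac =
      ∑ᶠ d : ℤ, ∑ i, ∑ j, m i j • wedge (mode i (d + k)) (contract (mode j d) vac) := by
  rw [leibniz, vac, Finsupp.linearCombination_single, one_smul]

/-- A factor of nonnegative degree is still present after a different factor is removed from the
vacuum. The two can coincide only for `ℓ = 0` on the diagonal, where skew-symmetry gives `m i i =
0`. -/
theorem HasParity.smul_wedge_contract_vac {ℓ : ℕ} {m : Matrix (Fin n) (Fin n) ℂ}
    (h : HasParity ℓ m) {d e : ℤ} (hde : d = e + ℓ ∨ e = d + ℓ) (hd : 0 ≤ d) (i j : Fin n) :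
    m i j • wedge (mode i d) (contract (mode j e) vac) = 0 := by
  by_cases hij : mode i d = mode j e
  · obtain ⟨rfl, rfl⟩ := mode_injective.1 hij
    obtain rfl : ℓ = 0 := by omega
    rw [h.diag_eq_zero, zero_smul]
  · rw [wedge_contract_vac_of_ne hij hd, smul_zero]

theorem HasParity.leibniz_plus_vac {ℓ : ℕ} {m : Matrix (Fin n) (Fin n) ℂ} (h : HasParity ℓ m) :
    leibniz m ℓ vac = 0 := by
  rw [leibniz_vac]
  refine finsum_eq_zero_of_forall_eq_zero fun d =>
    Finset.sum_eq_zero fun i _ => Finset.sum_eq_zero fun j _ => ?_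
  rcases lt_or_ge d 0 with hd | hd
  · simp [contract_vac (p := mode j d) hd]
  · exact h.smul_wedge_contract_vac (Or.inl rfl) (by omega) i j

/-- The factor removed must occur in the vacuum, so `0 ≤ d`, and the factor added must not, so `d <
ℓ`. -/
theorem HasParity.leibniz_minus_vac {ℓ : ℕ} {m : Matrix (Fin n) (Fin n) ℂ} (h : HasParity ℓ m) :
    leibniz m (-(ℓ : ℤ)) vac =
      ∑ d ∈ Finset.range ℓ, ∑ i, ∑ j,
        m i j • wedge (mode i ((d : ℤ) - ℓ)) (contract (mode j d) vac) := by
  rw [leibniz_vac, finsum_eq_sum_of_support_subset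
    (s := (Finset.range ℓ).map Nat.castEmbedding), Finset.sum_map]
  · rfl
  · intro d hd
    by_contra hd'
    refine hd (Finset.sum_eq_zero fun i _ => Finset.sum_eq_zero fun j _ => ?_)
    rcases lt_or_ge d 0 with hd0 | hd0
    · simp [contract_vac (p := mode j d) hd0]
    · refine h.smul_wedge_contract_vac (Or.inr (by omega)) ?_ i j
      by_contra hlt
      refine hd' (Finset.mem_coe.2 (Finset.mem_map.2 ⟨d.toNat, Finset.mem_range.2 ?_, ?_⟩))
      · omega
      · exact Int.toNat_of_nonneg hd0

theorem expDeformation_zero (A : Op n) (X : Module.End ℂ (Fock n)) :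
    expDeformation A X 0 = A := by
  funext w v
  simp [expDeformation]

/-- Since the deformation acts on the right and `γ` has the vacuum there, the first order in `ε`
depends on `X` only through `X|0⟩`. -/
theorem matrixElement_expDeformation_one (A : Op n) (X : Module.End ℂ (Fock n)) (a : Fock n) :
    matrixElement (expDeformation A X 1) a vac = matrixElement A a (X vac) := by
  funext m
  refine finsum_congr fun x => ?_
  congr 1
  rw [vac, Finsupp.sum_single_index (mul_zero _), mul_one]
  simp [expDeformation]

theorem ddε_neg_mul_inv (N D : PowerSeries (K n)) (hD : PowerSeries.coeff 0 D ≠ 0) :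
    ddε (-N * D⁻¹) =
      -(PowerSeries.coeff 1 N * PowerSeries.coeff 0 D -
        PowerSeries.coeff 0 N * PowerSeries.coeff 1 D) / PowerSeries.coeff 0 D ^ 2 := by
  have hD' : PowerSeries.constantCoeff D ≠ 0 := by
    rwa [← PowerSeries.coeff_zero_eq_constantCoeff_apply]
  set f := -N * D⁻¹ with hf
  have hmul : f * D = -N := by
    rw [hf, mul_assoc, PowerSeries.inv_mul_cancel _ hD', mul_one]
  have h0 := congrArg PowerSeries.constantCoeff hmul
  have h1 := congrArg (PowerSeries.coeff 1) hmul
  rw [PowerSeries.coeff_mul, Finset.Nat.antidiagonal_succ] at h1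
  simp at h0 h1
  have hd : ddε f = PowerSeries.coeff 1 f := by
    rw [ddε, ← PowerSeries.coeff_zero_eq_constantCoeff_apply, PowerSeries.coeff_derivative]
    simp
  rw [hd, eq_div_iff (pow_ne_zero 2 hD)]
  simp only [PowerSeries.coeff_zero_eq_constantCoeff_apply]
  -- The quotient rule, read off from the coefficients at `ε^0` and `ε^1` of `f * D = -N`.
  linear_combination (PowerSeries.constantCoeff D) * h1 - (PowerSeries.coeff 1 D) * h0

end VanDeLeur

end

/-! ### The derivative of `γ`. -/

namespace VanDeLeur

variable {n : ℕ}

theorem neg_one_zpow_natCast_sub_one {F : Type*} [Field F] (d : ℕ) :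
    (-1 : F) ^ ((d : ℤ) - 1) = -(-1) ^ d := by
  rw [zpow_sub₀ (by norm_num), zpow_natCast, zpow_one, div_neg, div_one]

/-- The numerator given by the quotient rule is the determinant on the left of `element_plucker`,
with `X|0⟩` in place of `p ∧ ∂_q|0⟩`. -/
theorem ddε_gamma {A : Op n} (hτ : matrixElement A vac vac ≠ 0) (X : Module.End ℂ (Fock n))
    (i j : Fin n) :
    ddε (gamma (expDeformation A X) i j) =
      -algebraMap (MvPowerSeries (Fin n) ℂ) (K n)
        (element A (wedge (mode i (-1)) (contract (mode j 0) vac)) (X vac) * element A vac vac -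
          element A (wedge (mode i (-1)) (contract (mode j 0) vac)) vac *
            element A vac (X vac)) /
        algebraMap (MvPowerSeries (Fin n) ℂ) (K n) (element A vac vac) ^ 2 := by
  have hD : algebraMap (MvPowerSeries (Fin n) ℂ) (K n) (element A vac vac) ≠ 0 := by
    rwa [Ne, FaithfulSMul.algebraMap_eq_zero_iff]
  have h0 : ∀ a, PowerSeries.coeff 0 (familyElement (expDeformation A X) a vac) =
      algebraMap (MvPowerSeries (Fin n) ℂ) (K n) (element A a vac) := fun a => by
    rw [familyElement, PowerSeries.coeff_mk, expDeformation_zero, element_apply]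
  have h1 : ∀ a, PowerSeries.coeff 1 (familyElement (expDeformation A X) a vac) =
      algebraMap (MvPowerSeries (Fin n) ℂ) (K n) (element A a (X vac)) := fun a => by
    rw [familyElement, PowerSeries.coeff_mk, matrixElement_expDeformation_one, element_apply]
  rw [gamma, Matrix.of_apply, ddε_neg_mul_inv _ _ (by rwa [h0]), h0, h0, h1, h1, map_sub, map_mul,
    map_mul]

/-- The variation of the numerator of `γ` along `r z^(-ℓ)`. -/
theorem IsSymplecticOp.element_leibniz_minus {A : Op n} (hA : IsSymplecticOp A)
    (hτ : matrixElement A vac vac ≠ 0) {ℓ : ℕ} {r : Matrix (Fin n) (Fin n) ℂ}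
    (hr : HasParity ℓ r) (i j : Fin n) :
    element A (wedge (mode i (-1)) (contract (mode j 0) vac)) (leibniz r (-(ℓ : ℤ)) vac) *
          element A vac vac -
        element A (wedge (mode i (-1)) (contract (mode j 0) vac)) vac *
          element A vac (leibniz r (-(ℓ : ℤ)) vac) =
      ∑ d ∈ Finset.range ℓ, ∑ a, ∑ b, r a b • ((-1 : ℂ) ^ d •
        (element A (wedge (mode j (-1)) vac) (wedge (mode b (-1 - (d : ℤ))) vac) *
          element A (wedge (mode i (-1)) vac) (wedge (mode a ((d : ℤ) - ℓ)) vac))) := by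
  simp only [hr.leibniz_minus_vac, map_sum, map_smul, Finset.sum_mul, Finset.mul_sum,
    ← Finset.sum_sub_distrib, smul_mul_assoc, mul_smul_comm, ← smul_sub]
  refine Finset.sum_congr rfl fun d hd => Finset.sum_congr rfl fun a _ =>
    Finset.sum_congr rfl fun b _ => ?_
  have hd' := Finset.mem_range.1 hd
  have h1 : deg (mode a ((d : ℤ) - ℓ)) < 0 := by
    rw [deg_mode]
    omega
  have h2 : 0 ≤ deg (mode b (d : ℤ)) := by
    rw [deg_mode]
    omega
  have h3 : 0 ≤ deg (mode j 0) := le_refl _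
  have h4 : deg (mode i (-1)) < 0 := by
    rw [deg_mode]
    omega
  -- The dual of `e_j z^0` is `e_j z^(-1)` and its sign is `1`; the dual of `e_b z^d` is `e_b
  -- z^(-1-d)`, and its sign `(-1)^d` is the one in the claim.
  have h := hA.element_contract_vac hτ h2 h3
  rw [modeParity, modeParity, deg_mode, deg_mode, zpow_zero, one_smul, zpow_natCast] at h
  rw [hA.element_plucker h1 h2 h4, h, smul_mul_assoc]
  rfl

end VanDeLeur

theorem mainTheorem1 (n ℓ : ℕ) (r s : Matrix (Fin n) (Fin n) ℂ)
    (hr : VanDeLeur.HasParity ℓ r) (hs : VanDeLeur.HasParity ℓ s)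
    (A : VanDeLeur.Op n) (hA : VanDeLeur.IsSymplecticOp A)
    (hτ : VanDeLeur.matrixElement A VanDeLeur.vac VanDeLeur.vac ≠ 0) :
    VanDeLeur.NDEq
      ((VanDeLeur.gamma
        (VanDeLeur.expDeformation A (VanDeLeur.leibniz r (-(ℓ : ℤ))))).map VanDeLeur.ddε)
      (∑ p ∈ (Finset.range ℓ ×ˢ Finset.range ℓ).filter (fun p => p.1 + p.2 + 1 = ℓ),
        (-1 : VanDeLeur.K n) ^ ((p.2 : ℤ) - 1) •
          (VanDeLeur.Psi A p.1 * r.map (algebraMap ℂ (VanDeLeur.K n)) *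
            (VanDeLeur.Psi A p.2).transpose)) ∧
    VanDeLeur.NDEq
      ((VanDeLeur.gamma
        (VanDeLeur.expDeformation A (VanDeLeur.leibniz s (ℓ : ℤ)))).map VanDeLeur.ddε)
      0 := by
  constructor
  · intro i j _
    -- The pairs with `i + j = ℓ - 1` are parametrized by `j = d`, the degree of the factor
    -- contracted out of the vacuum.
    have hsum : ∀ F : ℕ × ℕ → VanDeLeur.K n,
        ∑ p ∈ (Finset.range ℓ ×ˢ Finset.range ℓ).filter (fun p => p.1 + p.2 + 1 = ℓ), F p =
          ∑ d ∈ Finset.range ℓ, F (ℓ - 1 - d, d) := by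
      intro F
      refine Finset.sum_nbij' (fun p => p.2) (fun d => (ℓ - 1 - d, d)) ?_ ?_ ?_ ?_ ?_
      · intro p hp
        exact (Finset.mem_product.1 (Finset.mem_filter.1 hp).1).2
      · intro d hd
        simp only [Finset.mem_filter, Finset.mem_product, Finset.mem_range] at hd ⊢
        omega
      · rintro ⟨a, b⟩ hp
        have := (Finset.mem_filter.1 hp).2
        simp only at this
        ext <;> simp only
        omega
      · intro d _
        rfl
      · rintro ⟨a, b⟩ hp
        have := (Finset.mem_filter.1 hp).2
        simp only at this
        congr
        omega
    have hD : algebraMap (MvPowerSeries (Fin n) ℂ) (VanDeLeur.K n)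
        (VanDeLeur.element A VanDeLeur.vac VanDeLeur.vac) ≠ 0 := by
      rwa [Ne, FaithfulSMul.algebraMap_eq_zero_iff]
    rw [Matrix.map_apply, VanDeLeur.ddε_gamma hτ, hA.element_leibniz_minus hτ hr, Matrix.sum_apply,
      hsum]
    simp only [map_sum, ← Finset.sum_neg_distrib, Finset.sum_div]
    refine Finset.sum_congr rfl fun d hd => ?_
    have hd' := Finset.mem_range.1 hd
    rw [Matrix.smul_apply, Matrix.mul_apply, smul_eq_mul, Finset.mul_sum, Finset.sum_comm]
    refine Finset.sum_congr rfl fun b _ => ?_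
    rw [Matrix.mul_apply, Finset.sum_mul, Finset.mul_sum]
    refine Finset.sum_congr rfl fun a _ => ?_
    -- The added factor `e_a z^(d-ℓ)` is the one in the definition of `Ψ_{ℓ-1-d}`. The minus sign in
    -- `γ` combines with `(-1)^d` to `(-1)^(d-1)`, an integer power because `d` may be `0`.
    have hdeg : (-1 : ℤ) - ((ℓ - 1 - d : ℕ) : ℤ) = (d : ℤ) - ℓ := by omega
    have hpow : (-1 : VanDeLeur.K n) ^ ((d : ℤ) - 1) = -(-1) ^ d :=
      VanDeLeur.neg_one_zpow_natCast_sub_one d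
    rw [Algebra.smul_def, Algebra.smul_def, map_mul, map_mul, map_mul,
      ← IsScalarTower.algebraMap_apply, ← IsScalarTower.algebraMap_apply, map_pow, map_neg, map_one,
      Matrix.transpose_apply, Matrix.map_apply, VanDeLeur.Psi, VanDeLeur.Psi, Matrix.of_apply,
      Matrix.of_apply, hdeg, hpow]
    simp only [VanDeLeur.element_apply] at hD ⊢
    field_simp
  · intro i j _
    rw [Matrix.map_apply, VanDeLeur.ddε_gamma hτ, hs.leibniz_plus_vac]
    simp
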